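/- **Setting.** Let $N=\{1,\dots,n\}$ be agents and $M$ a finite set of goods. The valuations $v_1,\dots,v_n:2^M\to\mathbb R$ are *restricted additive*: each $v_i$ is additive and there are inherent values $v(g)>0$ $(g\in M)$ with $v_i(g)\in\{0,v(g)\}$ for all $i,g$; write $v(S)=\sum_{g\in S}v(g)$. A (partial) allocation $X=\langle X_1,\dots,X_n\rangle$ consists of pairwise disjoint subsets of $M$; its pool is $P_X=M\setminus\bigcup_iX_i$. $X$ is *EFX* if $v_i(X_i)\ge v_i(X_j\setminus\{g\})$ for all $i\ne j$ and $g\in X_j$. Agent $i$ *envies* a set $S$ if $v_i(S)>v_i(X_i)$. **Configurations.** A configuration $\sigma=(X,R)$ is an allocation with an ordered partition $R=\langle R_1,R_2,\dots\rangle$ of $N$. The representative of $R_\ell$ is $r_\ell=\arg\min_{j\in R_\ell}v_j(X_j)$; for $i\in R_\ell$ put $\theta_i=v_{r_\ell}(X_{r_\ell})$. If $v_i(S)>\theta_i$, let $\lfloor S\rfloor_i$ be a subset of $S$ of minimum cardinality with $v_i(\lfloor S\rfloor_i)>\theta_i$ (ties broken arbitrarily). Agent $i$ is a *champion* of $S$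 if $v_i(S)>\theta_i$ and $v_j(\lfloor S\rfloor_i\setminus\{g\})\le\theta_j$ for all $j\ne i$, $g\in\lfloor S\rfloor_i$. The *champion-graph* has a regular edge $i\to j$ if $v_i(X_j)>\theta_i$, and a champion edge $i\to j$ with label $g\in P_X$ if $i$ is a champion of $X_j\cup\{g\}$. A *champion cycle* is a cycle (loops allowed) of the champion-graph whose champion edges all end at representatives and have pairwise distinct labels, and which contains the representative of every group that it meets. Call $\sigma$ *proper* if $X$ is EFX; $v_i(X_i\setminus\{g\})\le\theta_i$ for all $i$ and $g\in X_i$; every agent is reachable by regular edges from the representative of its group; there is no regular edge from $R_\ell$ to $R_k$ for $\ell<k$; and $v_i(X_i)=v(X_i)$ for every non-representative $i$. **Envy-elimination** of an allocation $X$: first remove from every $X_i$ the goods that $i$ values at $0$. Then, while agents remain, let $r_\ell$ be a remaining agent with minimum $v_i(X_i)$, put $X'_{r_\ell}=X_{r_\ell}$ and $R_\ell=\{r_\ell\}$; as long as some $j\in R_\ell$ and some remaining $i$ satisfy $v_j(X_i)>v_{r_\ell}(X_{r_\ell})$, let $X'_i$ be a subset of $X_i$ of minimum cardinality with $v_j(X'_i)>v_{r_\ell}(X_{r_\ell})$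 and move $i$ to $R_\ell$; then pass to $\ell+1$. The result is $(X',\langle R_1,R_2,\dots\rangle)$. **Rules** (each also requires $\sigma$ to be proper). * $\mathsf U_0$: applicable if there are $g\in P_X$ and a representative $r$ with $v_r(g)=0$ and $v_i(X_r\cup\{g\})\le\theta_i$ for all $i$. Give $g$ to $r$ and keep $R$. * $\mathsf U_1$: applicable if there is a champion cycle. For each regular edge $i\to j$ of the cycle $i$ receives $X_j$, for each champion edge $i\to j$ with label $g$ agent $i$ receives $\lfloor X_j\cup\{g\}\rfloor_i$, other bundles are unchanged; then eliminate envy. * $\mathsf U_2$: applicable if $\mathsf U_0,\mathsf U_1$ are not and there are $g\in P_X$ and a representative $r$ with $v_r(g)=v(g)$. Give $g$ to $r$; then eliminate envy. * $\mathsf U_4$: applicable if some agent envies $P_X$. Take a champion $i\in R_\ell$ of $P_X$ and a path $r_\ell=j_1\to\dots\to j_p=i$ of regular edges; give $X_{j_{t+1}}$ to $j_t$ for $t<p$ and $\lfloor P_X\rfloor_i$ to $i$, other bundles are unchanged; then eliminate envy. **Algorithm.** Start with $X=\langle\emptyset,\dots,\emptyset\rangle$ and $R=\langle\{1\},\dots,\{n\}\rangle$;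 while one of $\mathsf U_0,\mathsf U_1,\mathsf U_2,\mathsf U_4$ is applicable, update by the applicable rule of minimum index; return $X$ and $P=P_X$. All choices are arbitrary. **Theorem.** For restricted additive valuations every execution of this algorithm terminates after finitely many updates: there is no infinite execution, and at every reachable configuration to which a rule is applicable an update can be carried out. The returned partial allocation $X$ and its pool $P$ satisfy * $X$ is EFX; * $v_i(X_i)\ge v_i(P)$ for every agent $i$; * if $n\ge2$, then $|P|<\lfloor n/2\rfloor$. -/

import Mathlib

namespace FairDivision

/-- A fair-division instance with agents `Fin n`, goods `G` and restricted additive valuations: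
every valuation is additive and every good `g` has an inherent value `base g > 0` such that each
agent values `g` at `0` or at `base g`. -/
structure RestrictedAdditiveInstance (n : ℕ) (G : Type*) where
  /-- `val i S` is the value of agent `i` for the set `S` of goods -/
  val : Fin n → Finset G → ℝ
  /-- the inherent value of a good -/
  base : G → ℝ
  additive : ∀ i S, val i S = ∑ g ∈ S, val i {g}
  base_pos : ∀ g, 0 < base g
  restricted : ∀ i g, val i {g} = 0 ∨ val i {g} = base g

section Allocations

variable {n : ℕ} {G : Type*} [Fintype G] [DecidableEq G]

/-- A (partial) allocation: the bundles are pairwise disjoint. -/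
def IsAllocation (X : Fin n → Finset G) : Prop :=
  ∀ i j, i ≠ j → Disjoint (X i) (X j)

/-- The pool: the goods that are not allocated to any agent. -/
def pool (X : Fin n → Finset G) : Finset G :=
  (Finset.univ.biUnion X)ᶜ

/-- Envy-freeness up to any `k` goods. -/
def IsEFkX (k : ℕ) (v : Fin n → Finset G → ℝ) (X : Fin n → Finset G) : Prop :=
  ∀ i j, i ≠ j → ∀ T, T ⊆ X j → T.card = min k (X j).card → v i (X j \ T) ≤ v i (X i)

/-- Envy-freeness up to any good. -/
def IsEFX (v : Fin n → Finset G → ℝ) (X : Fin n → Finset G) : Prop :=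
  IsEFkX 1 v X

/-- `T` is a subset of `S` with the minimum number of elements among those whose value under `u`
exceeds `θ`. -/
def IsChampSet (u : Finset G → ℝ) (θ : ℝ) (S T : Finset G) : Prop :=
  T ⊆ S ∧ θ < u T ∧ ∀ T', T' ⊆ S → θ < u T' → T.card ≤ T'.card

end Allocations

/-- A configuration `(X, R)`. The ordered partition `R = ⟨R₁, R₂, …⟩` of the agents is given by
the index of the group of each agent: `R_ℓ = {i | grp i = ℓ}`. -/
structure Config (n : ℕ) (G : Type*) where
  /-- the bundle of each agent -/
  alloc : Fin n → Finset G
  /-- the index of the group of each agent -/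
  grp : Fin n → ℕ

section Configurations

variable {n : ℕ} {G : Type*} [Fintype G] [DecidableEq G]

/-- The value `v_{r_ℓ}(X_{r_ℓ})` of the representative of the group `R_ℓ` containing `i`, that is
the minimum of `v_j(X_j)` over all `j` in the group of `i`. -/
noncomputable def repValue (I : RestrictedAdditiveInstance n G) (σ : Config n G) (i : Fin n) : ℝ :=
  (Finset.univ.filter (fun j => σ.grp j = σ.grp i)).inf' ⟨i, by simp⟩
    (fun j => I.val j (σ.alloc j))

/-- `r` is the representative of its group: it attains the minimum of `v_j(X_j)` over the group. -/
def IsRep (I : RestrictedAdditiveInstance n G) (σ : Config n G) (r : Fin n) : Prop :=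
  I.val r (σ.alloc r) = repValue I σ r

/-- Envy-compatibility. -/
def EnvyCompatible (I : RestrictedAdditiveInstance n G) (σ : Config n G) : Prop :=
  ∀ i, ∀ g ∈ σ.alloc i, I.val i (σ.alloc i \ {g}) ≤ repValue I σ i

/-- Regular edges of the champion-graph. -/
def RegularEdge (I : RestrictedAdditiveInstance n G) (σ : Config n G) (i j : Fin n) : Prop :=
  repValue I σ i < I.val i (σ.alloc j)

/-- Admissibility. -/
structure Admissible (I : RestrictedAdditiveInstance n G) (σ : Config n G) : Prop where
  path : ∀ r i, IsRep I σ r → σ.grp r = σ.grp i →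
    Relation.ReflTransGen (RegularEdge I σ) r i
  no_forward_edge : ∀ i j, σ.grp i < σ.grp j → I.val i (σ.alloc j) ≤ repValue I σ i
  nonwasteful : ∀ i, ¬ IsRep I σ i → I.val i (σ.alloc i) = ∑ g ∈ σ.alloc i, I.base g

/-- The three properties required of a configuration before any update. -/
def Proper (I : RestrictedAdditiveInstance n G) (σ : Config n G) : Prop :=
  IsEFX I.val σ.alloc ∧ EnvyCompatible I σ ∧ Admissible I σ

/-- `ch σ S i` stands for the set `⌊S⌋_i` with respect to the configuration `σ`: a minimum-size
subset of `S` which `i` values more than the representative of her group values her own bundle,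
whenever such a subset exists. Ties are broken arbitrarily by the function `ch`. -/
def IsChampChoice (I : RestrictedAdditiveInstance n G)
    (ch : Config n G → Finset G → Fin n → Finset G) : Prop :=
  ∀ σ S i, repValue I σ i < I.val i S → IsChampSet (I.val i) (repValue I σ i) S (ch σ S i)

/-- Agent `i` is a champion of `S`. -/
def IsChampion (I : RestrictedAdditiveInstance n G)
    (ch : Config n G → Finset G → Fin n → Finset G)
    (σ : Config n G) (i : Fin n) (S : Finset G) : Prop :=
  repValue I σ i < I.val i S ∧
    ∀ j, j ≠ i → ∀ g ∈ ch σ S i, I.val j (ch σ S i \ {g}) ≤ repValue I σ j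

/-- There is a champion edge from `i` to `j` with label `g`. -/
def ChampionEdge (I : RestrictedAdditiveInstance n G)
    (ch : Config n G → Finset G → Fin n → Finset G)
    (σ : Config n G) (i j : Fin n) (g : G) : Prop :=
  g ∈ pool σ.alloc ∧ IsChampion I ch σ i (σ.alloc j ∪ {g})

/-- The cycle `c 0 → c 1 → ⋯ → c m → c 0` of the champion-graph is a champion cycle. The edge from
`c t` to `c (t + 1)` (indices modulo `m + 1`) is regular if `lab t = none`, and is a champion edge
with label `g` if `lab t = some g`. Length-one cycles (loops) are allowed. -/
structure IsChampionCycle (I : RestrictedAdditiveInstance n G)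
    (ch : Config n G → Finset G → Fin n → Finset G) (σ : Config n G)
    {m : ℕ} (c : Fin (m + 1) → Fin n) (lab : Fin (m + 1) → Option G) : Prop where
  injective : Function.Injective c
  regular : ∀ t, lab t = none → RegularEdge I σ (c t) (c (t + 1))
  champion : ∀ t g, lab t = some g → ChampionEdge I ch σ (c t) (c (t + 1)) g
  champion_to_rep : ∀ t g, lab t = some g → IsRep I σ (c (t + 1))
  labels_distinct : ∀ s t g, lab s = some g → lab t = some g → s = t
  /-- the cycle contains the representative of every group that it meets -/
  meets_rep : ∀ t, ∃ s, σ.grp (c s) = σ.grp (c t) ∧ IsRep I σ (c s)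

end Configurations

section EnvyElimination

variable {n : ℕ} {G : Type*} [Fintype G] [DecidableEq G]

/-- The allocation obtained from `X` by retaking all wasted goods. -/
noncomputable def removeWaste (I : RestrictedAdditiveInstance n G) (X : Fin n → Finset G) :
    Fin n → Finset G :=
  fun i => (X i).filter (fun g => I.val i {g} ≠ 0)

/-- A state of the envy-elimination process: the set `N` of agents that are not yet in a group, the
index `ℓ` of the current group, its members `R_ℓ`, the value `θ = v_{r_ℓ}(X_{r_ℓ})` of its
representative, and the output (bundles and groups) built so far. -/
structure ElimState (n : ℕ) (G : Type*) where
  /-- agents not yet placed in a group -/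
  remaining : Finset (Fin n)
  /-- index of the current group -/
  idx : ℕ
  /-- members of the current group -/
  current : Finset (Fin n)
  /-- value of the representative of the current group for her bundle -/
  θ : ℝ
  /-- the output built so far -/
  out : Config n G

/-- One step of the envy-elimination process on the non-wasteful allocation `W`. All choices
(the argmin, the pair `(j, i)`, the set `⌊W_i⌋_j`) are arbitrary. -/
inductive ElimStep (I : RestrictedAdditiveInstance n G) (W : Fin n → Finset G) :
    ElimState n G → ElimState n G → Prop
  /-- body of the inner loop: agent `j` of the current group envies the remaining agent `i` -/
  | join (s : ElimState n G) (i j : Fin n) (T : Finset G)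
      (hj : j ∈ s.current) (hi : i ∈ s.remaining) (henvy : s.θ < I.val j (W i))
      (hT : IsChampSet (I.val j) s.θ (W i) T) :
      ElimStep I W s
        { remaining := s.remaining.erase i
          idx := s.idx
          current := insert i s.current
          θ := s.θ
          out := ⟨Function.update s.out.alloc i T, Function.update s.out.grp i s.idx⟩ }
  /-- the inner loop is over and a new group is opened with representative `r` -/
  | newGroup (s : ElimState n G) (r : Fin n)
      (hdone : ∀ j ∈ s.current, ∀ i ∈ s.remaining, I.val j (W i) ≤ s.θ)
      (hr : r ∈ s.remaining) (hmin : ∀ i ∈ s.remaining, I.val r (W r) ≤ I.val i (W i)) :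
      ElimStep I W s
        { remaining := s.remaining.erase r
          idx := s.idx + 1
          current := {r}
          θ := I.val r (W r)
          out := ⟨Function.update s.out.alloc r (W r),
                  Function.update s.out.grp r (s.idx + 1)⟩ }

/-- The state before the first group is opened. -/
def elimStart : ElimState n G where
  remaining := Finset.univ
  idx := 0
  current := ∅
  θ := 0
  out := ⟨fun _ => ∅, fun _ => 0⟩

/-- `σ'` is a possible output of the envy-elimination process on the allocation `X`. -/
def EnvyElimination (I : RestrictedAdditiveInstance n G) (X : Fin n → Finset G)
    (σ' : Config n G) : Prop :=
  ∃ s, Relation.ReflTransGen (ElimStep I (removeWaste I X)) elimStart s ∧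
    s.remaining = ∅ ∧ s.out = σ'

end EnvyElimination

section Rules

variable {n : ℕ} {G : Type*} [Fintype G] [DecidableEq G]

/-- Precondition of rule `U₀`, for the good `g` and the representative `r`. -/
def U0Pre (I : RestrictedAdditiveInstance n G) (σ : Config n G) (g : G) (r : Fin n) : Prop :=
  Proper I σ ∧ g ∈ pool σ.alloc ∧ IsRep I σ r ∧ I.val r {g} = 0 ∧
    ∀ i, I.val i (σ.alloc r ∪ {g}) ≤ repValue I σ i

/-- Rule `U₀` is applicable. -/
def U0Applicable (I : RestrictedAdditiveInstance n G) (σ : Config n G) : Prop :=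
  ∃ g r, U0Pre I σ g r

/-- Update via rule `U₀`. -/
def U0 (I : RestrictedAdditiveInstance n G) (σ σ' : Config n G) : Prop :=
  ∃ g r, U0Pre I σ g r ∧
    σ' = ⟨Function.update σ.alloc r (σ.alloc r ∪ {g}), σ.grp⟩

/-- Rule `U₁` is applicable. -/
def U1Applicable (I : RestrictedAdditiveInstance n G)
    (ch : Config n G → Finset G → Fin n → Finset G) (σ : Config n G) : Prop :=
  Proper I σ ∧ ∃ (m : ℕ) (c : Fin (m + 1) → Fin n) (lab : Fin (m + 1) → Option G),
    IsChampionCycle I ch σ c lab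

/-- Update via rule `U₁`: shift the bundles along a champion cycle, then eliminate envy. -/
def U1 (I : RestrictedAdditiveInstance n G)
    (ch : Config n G → Finset G → Fin n → Finset G) (σ σ' : Config n G) : Prop :=
  Proper I σ ∧ ∃ (m : ℕ) (c : Fin (m + 1) → Fin n) (lab : Fin (m + 1) → Option G),
    IsChampionCycle I ch σ c lab ∧
    ∃ Y : Fin n → Finset G,
      (∀ t, lab t = none → Y (c t) = σ.alloc (c (t + 1))) ∧
      (∀ t g, lab t = some g → Y (c t) = ch σ (σ.alloc (c (t + 1)) ∪ {g}) (c t)) ∧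
      (∀ j, (∀ t, c t ≠ j) → Y j = σ.alloc j) ∧
      EnvyElimination I Y σ'

/-- Precondition of rule `U₂` (apart from `U₀` and `U₁` not being applicable), for the good `g`
and the representative `r`. -/
def U2Pre (I : RestrictedAdditiveInstance n G) (σ : Config n G) (g : G) (r : Fin n) : Prop :=
  Proper I σ ∧ g ∈ pool σ.alloc ∧ IsRep I σ r ∧ I.val r {g} = I.base g

/-- Rule `U₂` is applicable. -/
def U2Applicable (I : RestrictedAdditiveInstance n G)
    (ch : Config n G → Finset G → Fin n → Finset G) (σ : Config n G) : Prop :=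
  ¬ U0Applicable I σ ∧ ¬ U1Applicable I ch σ ∧ ∃ g r, U2Pre I σ g r

/-- Update via rule `U₂`. -/
def U2 (I : RestrictedAdditiveInstance n G)
    (ch : Config n G → Finset G → Fin n → Finset G) (σ σ' : Config n G) : Prop :=
  ¬ U0Applicable I σ ∧ ¬ U1Applicable I ch σ ∧ ∃ g r, U2Pre I σ g r ∧
    EnvyElimination I (Function.update σ.alloc r (σ.alloc r ∪ {g})) σ'

/-- Rule `U₄` is applicable: some agent envies the pool. -/
def U4Applicable (I : RestrictedAdditiveInstance n G) (σ : Config n G) : Prop :=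
  Proper I σ ∧ ∃ i, I.val i (σ.alloc i) < I.val i (pool σ.alloc)

/-- Update via rule `U₄`: `p 0 → p 1 → ⋯ → p m` is a path of regular edges from the representative
of a group to a member `p m` of that group who is a champion of the pool. -/
def U4 (I : RestrictedAdditiveInstance n G)
    (ch : Config n G → Finset G → Fin n → Finset G) (σ σ' : Config n G) : Prop :=
  U4Applicable I σ ∧ ∃ (m : ℕ) (p : Fin (m + 1) → Fin n),
    Function.Injective p ∧
    IsRep I σ (p 0) ∧ σ.grp (p 0) = σ.grp (p (Fin.last m)) ∧
    IsChampion I ch σ (p (Fin.last m)) (pool σ.alloc) ∧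
    (∀ t : Fin m, RegularEdge I σ (p t.castSucc) (p t.succ)) ∧
    ∃ Y : Fin n → Finset G,
      (∀ t : Fin m, Y (p t.castSucc) = σ.alloc (p t.succ)) ∧
      Y (p (Fin.last m)) = ch σ (pool σ.alloc) (p (Fin.last m)) ∧
      (∀ k, (∀ t, p t ≠ k) → Y k = σ.alloc k) ∧
      EnvyElimination I Y σ'

end Rules

section Algorithm

variable {n : ℕ} {G : Type*} [Fintype G] [DecidableEq G]

/-- The initial configuration: nothing is allocated and the groups are `{1}, {2}, …, {n}`. -/
def initial : Config n G where
  alloc := fun _ => ∅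
  grp := fun i => i.val + 1

/-- One iteration of the main loop: an update via the applicable rule of minimum index. -/
def AlgStep (I : RestrictedAdditiveInstance n G)
    (ch : Config n G → Finset G → Fin n → Finset G) (σ σ' : Config n G) : Prop :=
  U0 I σ σ' ∨
  (¬ U0Applicable I σ ∧ U1 I ch σ σ') ∨
  (¬ U0Applicable I σ ∧ ¬ U1Applicable I ch σ ∧ U2 I ch σ σ') ∨
  (¬ U0Applicable I σ ∧ ¬ U1Applicable I ch σ ∧ ¬ U2Applicable I ch σ ∧ U4 I ch σ σ')

/-- The exit condition of the main loop: no rule is applicable. -/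
def Halted (I : RestrictedAdditiveInstance n G)
    (ch : Config n G → Finset G → Fin n → Finset G) (σ : Config n G) : Prop :=
  ¬ U0Applicable I σ ∧ ¬ U1Applicable I ch σ ∧ ¬ U2Applicable I ch σ ∧ ¬ U4Applicable I σ

/-- `σ` occurs in some execution of the algorithm. -/
def Reachable (I : RestrictedAdditiveInstance n G)
    (ch : Config n G → Finset G → Fin n → Finset G) (σ : Config n G) : Prop :=
  Relation.ReflTransGen (AlgStep I ch) initial σ

end Algorithm

end FairDivision

namespace FairDivision

variable {n : ℕ} {G : Type*}

/-! ### Restricted additive valuations -/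

namespace RestrictedAdditiveInstance

variable (I : RestrictedAdditiveInstance n G)

/-! The leverage of restricted additivity is that a minimum-size set exceeding a threshold contains
no good its evaluator values at 0. Its value is therefore its inherent value, an upper bound for
every agent. In envy-elimination, a bundle cut down by `j` from a waste-free bundle of `i` is worth
the same to both, namely more than θ, while after the loss of any one good its inherent value is at
most θ. Thresholds do not decrease from group to group, so later groups cannot object, and earlier
groups do not envy the uncut bundles either. This gives properness, a unique representative per
group, and no regular edge into a representative: the `Invariant`, obtained in `ElimInv.invariant`
from the loop invariant `ElimInv`.

Termination uses a potential that reads the thresholds from the smallest upwards and counts, at each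
one, first the representatives and then the agents outside their groups. A rule that eliminates envy
changes bundles only on a set of agents who all rise above their thresholds and which contains the
representative of every group it meets; `EnvyElimination.weightLT` shows that this lowers the
potential. The rule without envy-elimination preserves the potential and shrinks the pool.

At a halted configuration the pool is not envied, since the last rule does not apply. For its size:
representatives value every pool good at 0, so adding such a good to a representative's bundle
creates a champion who is not a representative. Groups with at least two members number at most `n /
2`. With that many pool goods, each of them could get its own label, and walking backwards along
shortest-path trees inside groups and along champion edges between groups would close up into a
champion cycle (`Invariant.exists_isChampionCycle`). -/

lemma val_singleton_nonneg (i : Fin n) (g : G) : 0 ≤ I.val i {g} := by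
  rcases I.restricted i g with h | h
  · exact h.ge
  · exact h ▸ (I.base_pos g).le

lemma val_singleton_le_base (i : Fin n) (g : G) : I.val i {g} ≤ I.base g := by
  rcases I.restricted i g with h | h
  · exact h ▸ (I.base_pos g).le
  · exact h.le

lemma val_mono (i : Fin n) {S T : Finset G} (h : S ⊆ T) : I.val i S ≤ I.val i T := by
  rw [I.additive i S, I.additive i T]
  exact Finset.sum_le_sum_of_subset_of_nonneg h fun g _ _ => I.val_singleton_nonneg i g

lemma val_le_sum_base (i : Fin n) (S : Finset G) : I.val i S ≤ ∑ g ∈ S, I.base g := by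
  rw [I.additive i S]
  exact Finset.sum_le_sum fun g _ => I.val_singleton_le_base i g

lemma val_eq_sum_base {i : Fin n} {S : Finset G} (h : ∀ g ∈ S, I.val i {g} = I.base g) :
    I.val i S = ∑ g ∈ S, I.base g := by
  rw [I.additive i S]
  exact Finset.sum_congr rfl h

variable [DecidableEq G]

lemma val_sdiff_singleton (i : Fin n) {S : Finset G} {g : G} (hg : g ∈ S) :
    I.val i (S \ {g}) + I.val i {g} = I.val i S := by
  rw [I.additive i S, I.additive i (S \ {g}), Finset.sdiff_singleton_eq_erase,
    Finset.sum_erase_add _ _ hg]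

lemma val_union_singleton (i : Fin n) {S : Finset G} {g : G} (hg : g ∉ S) :
    I.val i (S ∪ {g}) = I.val i S + I.val i {g} := by
  rw [I.additive i (S ∪ {g}), I.additive i S, Finset.sum_union (by simpa using hg)]
  simp

end RestrictedAdditiveInstance

/-! ### Minimum-size sets exceeding a threshold -/

section ChampSet

lemma exists_isChampSet (u : Finset G → ℝ) (θ : ℝ) (S : Finset G) (h : θ < u S) :
    ∃ T, IsChampSet u θ S T := by
  classical
  obtain ⟨T, hT, hmin⟩ := Finset.exists_min_image (S.powerset.filter fun T => θ < u T)
    Finset.card ⟨S, by simpa using h⟩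
  simp only [Finset.mem_filter, Finset.mem_powerset] at hT hmin
  exact ⟨T, hT.1, hT.2, fun T' h₁ h₂ => hmin T' ⟨h₁, h₂⟩⟩

variable [DecidableEq G]

lemma IsChampSet.sdiff_le {u : Finset G → ℝ} {θ : ℝ} {S T : Finset G} (h : IsChampSet u θ S T)
    {g : G} (hg : g ∈ T) : u (T \ {g}) ≤ θ := by
  by_contra! hlt
  have h₁ := h.2.2 (T \ {g}) (Finset.sdiff_subset.trans h.1) hlt
  rw [Finset.sdiff_singleton_eq_erase] at h₁
  exact absurd h₁ (not_le.2 (Finset.card_erase_lt_of_mem hg))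

/-- A good of value 0 could be dropped without going below the threshold, against minimality. -/
lemma IsChampSet.val_eq_base {I : RestrictedAdditiveInstance n G} {i : Fin n} {θ : ℝ}
    {S T : Finset G} (h : IsChampSet (I.val i) θ S T) {g : G} (hg : g ∈ T) :
    I.val i {g} = I.base g := by
  refine (I.restricted i g).resolve_left fun h0 => ?_
  have h₁ := I.val_sdiff_singleton i hg
  have h₂ := h.sdiff_le hg
  have h₃ := h.2.1
  linarith

/-- Stated for the inherent value rather than for `i`, so that the bound passes to all agents at
once. -/
lemma IsChampSet.sum_base_sdiff_le {I : RestrictedAdditiveInstance n G} {i : Fin n} {θ : ℝ}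
    {S T : Finset G} (h : IsChampSet (I.val i) θ S T) {g : G} (hg : g ∈ T) :
    ∑ x ∈ T \ {g}, I.base x ≤ θ := by
  rw [← I.val_eq_sum_base fun x hx => h.val_eq_base (Finset.mem_sdiff.1 hx).1]
  exact h.sdiff_le hg

end ChampSet

/-! ### Representatives and thresholds -/

section RepValue

lemma repValue_le (I : RestrictedAdditiveInstance n G) (σ : Config n G) {i j : Fin n}
    (h : σ.grp j = σ.grp i) : repValue I σ i ≤ I.val j (σ.alloc j) :=
  Finset.inf'_le (fun j => I.val j (σ.alloc j)) (by simpa using h)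

lemma repValue_le_self (I : RestrictedAdditiveInstance n G) (σ : Config n G) (i : Fin n) :
    repValue I σ i ≤ I.val i (σ.alloc i) :=
  repValue_le I σ rfl

lemma repValue_congr (I : RestrictedAdditiveInstance n G) (σ : Config n G) {i j : Fin n}
    (h : σ.grp i = σ.grp j) : repValue I σ i = repValue I σ j := by
  simp only [repValue, h]

lemma exists_isRep (I : RestrictedAdditiveInstance n G) (σ : Config n G) (i : Fin n) :
    ∃ r, IsRep I σ r ∧ σ.grp r = σ.grp i := by
  obtain ⟨r, hr, h⟩ := Finset.exists_mem_eq_inf' (s := Finset.univ.filter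
    fun j => σ.grp j = σ.grp i) ⟨i, by simp⟩ (fun j => I.val j (σ.alloc j))
  have hr' : σ.grp r = σ.grp i := by simpa using hr
  refine ⟨r, ?_, hr'⟩
  rw [IsRep, repValue_congr I σ hr']
  exact h.symm

lemma repValue_eq (I : RestrictedAdditiveInstance n G) (σ : Config n G) {i r : Fin n}
    (hr : σ.grp r = σ.grp i)
    (h : ∀ j, σ.grp j = σ.grp i → I.val r (σ.alloc r) ≤ I.val j (σ.alloc j)) :
    repValue I σ i = I.val r (σ.alloc r) :=
  le_antisymm (repValue_le I σ hr)
    (Finset.le_inf' _ _ fun j hj => h j (by simpa using hj))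

end RepValue

/-! ### Loop invariant of envy-elimination -/

section Elimination

lemma exists_elimStep (I : RestrictedAdditiveInstance n G) (W : Fin n → Finset G)
    (s : ElimState n G) (h : s.remaining.Nonempty) :
    ∃ s', ElimStep I W s s' ∧ s'.remaining.card < s.remaining.card := by
  by_cases hd : ∀ j ∈ s.current, ∀ i ∈ s.remaining, I.val j (W i) ≤ s.θ
  · obtain ⟨r, hr, hmin⟩ := Finset.exists_min_image s.remaining (fun i => I.val i (W i)) h
    exact ⟨_, .newGroup s r hd hr hmin, Finset.card_erase_lt_of_mem hr⟩
  · push Not at hd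
    obtain ⟨j, hj, i, hi, hlt⟩ := hd
    obtain ⟨T, hT⟩ := exists_isChampSet _ _ _ hlt
    exact ⟨_, .join s i j T hj hi hlt hT, Finset.card_erase_lt_of_mem hi⟩

lemma exists_elimSteps (I : RestrictedAdditiveInstance n G) (W : Fin n → Finset G) (m : ℕ) :
    ∀ s : ElimState n G, s.remaining.card = m →
      ∃ s', Relation.ReflTransGen (ElimStep I W) s s' ∧ s'.remaining = ∅ := by
  induction m using Nat.strong_induction_on with
  | _ m ih =>
    intro s hs
    rcases s.remaining.eq_empty_or_nonempty with he | hne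
    · exact ⟨s, .refl, he⟩
    · obtain ⟨s₁, h₁, hlt⟩ := exists_elimStep I W s hne
      obtain ⟨s₂, h₂, he⟩ := ih _ (hs ▸ hlt) s₁ rfl
      exact ⟨s₂, .head h₁ h₂, he⟩

variable [DecidableEq G]

/-- What holds at every state of the envy-elimination process on `W`; the map `ρ` sends an agent
that already belongs to a group to the agent who opened that group. -/
structure ElimInv (I : RestrictedAdditiveInstance n G) (W : Fin n → Finset G)
    (s : ElimState n G) (ρ : Fin n → Fin n) : Prop where
  mem_current : ∀ i, i ∈ s.current ↔ i ∉ s.remaining ∧ s.out.grp i = s.idx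
  grp_le : ∀ i, i ∉ s.remaining → s.out.grp i ≤ s.idx
  rep_mem : ∀ i, i ∉ s.remaining → ρ i ∉ s.remaining
  rep_rep : ∀ i, i ∉ s.remaining → ρ (ρ i) = ρ i
  rep_eq_iff : ∀ i j, i ∉ s.remaining → j ∉ s.remaining →
    (ρ i = ρ j ↔ s.out.grp i = s.out.grp j)
  alloc_rep : ∀ i, i ∉ s.remaining → ρ i = i → s.out.alloc i = W i
  alloc_subset : ∀ i, i ∉ s.remaining → s.out.alloc i ⊆ W i
  rep_lt : ∀ i, i ∉ s.remaining → ρ i ≠ i → I.val (ρ i) (W (ρ i)) < I.val i (s.out.alloc i)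
  tight : ∀ i, i ∉ s.remaining → ρ i ≠ i → ∀ g ∈ s.out.alloc i,
    ∑ x ∈ s.out.alloc i \ {g}, I.base x ≤ I.val (ρ i) (W (ρ i))
  theta_current : ∀ i ∈ s.current, s.θ = I.val (ρ i) (W (ρ i))
  no_edge_to_remaining : ∀ i j, i ∉ s.remaining → j ∈ s.remaining → s.out.grp i < s.idx →
    I.val i (W j) ≤ I.val (ρ i) (W (ρ i))
  no_forward_edge : ∀ i j, i ∉ s.remaining → j ∉ s.remaining → s.out.grp i < s.out.grp j →
    I.val i (W j) ≤ I.val (ρ i) (W (ρ i))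
  mono : ∀ i j, i ∉ s.remaining → j ∉ s.remaining → s.out.grp i ≤ s.out.grp j →
    I.val (ρ i) (W (ρ i)) ≤ I.val (ρ j) (W (ρ j))
  le_remaining : ∀ i j, i ∉ s.remaining → j ∈ s.remaining →
    I.val (ρ i) (W (ρ i)) ≤ I.val j (W j)
  path : ∀ i, i ∉ s.remaining → Relation.ReflTransGen (fun a b => a ∉ s.remaining ∧
    b ∉ s.remaining ∧ I.val (ρ a) (W (ρ a)) < I.val a (s.out.alloc b)) (ρ i) i

variable {I : RestrictedAdditiveInstance n G} {W : Fin n → Finset G}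

lemma update_of_notMem {α β : Type*} [DecidableEq α] {s : Finset α} {i k : α} {f : α → β} {b : β}
    (hi : i ∈ s) (hk : k ∉ s) : Function.update f i b k = f k :=
  Function.update_of_ne (by rintro rfl; exact hk hi) _ _

lemma elimInv_start : ElimInv I W elimStart id := by
  constructor <;> simp [elimStart]

/-- The newcomer inherits the opener of `j`'s group and enters strictly above the threshold, so the
opener stays the unique minimum. The edge from `j` to the newcomer extends the path from the opener.
-/
lemma ElimInv.join (hW : ∀ i, ∀ g ∈ W i, I.val i {g} = I.base g) {s : ElimState n G}
    {ρ : Fin n → Fin n} (h : ElimInv I W s ρ) {i j : Fin n} {T : Finset G}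
    (hj : j ∈ s.current) (hi : i ∈ s.remaining)
    (hT : IsChampSet (I.val j) s.θ (W i) T) :
    ElimInv I W
      { remaining := s.remaining.erase i
        idx := s.idx
        current := insert i s.current
        θ := s.θ
        out := ⟨Function.update s.out.alloc i T, Function.update s.out.grp i s.idx⟩ }
      (Function.update ρ i (ρ j)) := by
  obtain ⟨hjr, hjg⟩ := (h.mem_current j).1 hj
  have hθ := h.theta_current j hj
  have hne : ∀ k, k ∉ s.remaining → k ≠ i := fun k hk e => hk (e ▸ hi)
  have hrj := h.rep_mem j hjr
  have hrji := hne _ hrj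
  have hmem : ∀ k, k ∉ s.remaining.erase i ↔ k = i ∨ k ∉ s.remaining := by
    intro k; rw [Finset.mem_erase]; tauto
  have hnl := h.rep_mem
  -- Both `i` and `j` value `T` at its full inherent value: `i` because `W i` has no waste, `j`
  -- because `T` has minimum size.
  have hval : s.θ < I.val i T := by
    have h₁ : I.val i T = I.val j T := by
      rw [I.val_eq_sum_base fun g hg => hW i g (hT.1 hg),
        I.val_eq_sum_base fun g hg => hT.val_eq_base hg]
    exact h₁ ▸ hT.2.1
  have hi' : Function.update ρ i (ρ j) i = ρ j := Function.update_self ..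
  constructor
  case mem_current =>
    intro k
    simp only [hmem, Finset.mem_insert, h.mem_current]
    by_cases hk : k = i
    · simp [hk]
    · simp [hk]
  case path =>
    have key : ∀ a b, (a ∉ s.remaining ∧ b ∉ s.remaining ∧
        I.val (ρ a) (W (ρ a)) < I.val a (s.out.alloc b)) →
        (a ∉ s.remaining.erase i ∧ b ∉ s.remaining.erase i ∧
        I.val (Function.update ρ i (ρ j) a) (W (Function.update ρ i (ρ j) a)) <
          I.val a (Function.update s.out.alloc i T b)) := by
      rintro a b ⟨ha, hb, hab⟩
      rw [update_of_notMem hi ha, update_of_notMem hi hb, hmem, hmem]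
      exact ⟨Or.inr ha, Or.inr hb, hab⟩
    intro k hk
    rcases (hmem k).1 hk with rfl | hk
    · simp only [hi']
      refine Relation.ReflTransGen.tail (Relation.ReflTransGen.mono key _ _ (h.path j hjr)) ?_
      refine ⟨(hmem _).2 (Or.inr hjr), (hmem _).2 (Or.inl rfl), ?_⟩
      rw [update_of_notMem hi hjr, Function.update_self, ← hθ]
      exact hT.2.1
    · simp only [update_of_notMem hi hk]
      exact Relation.ReflTransGen.mono key _ _ (h.path k hk)
  all_goals
    try simp only [hmem]
    try simp only [Finset.mem_erase, Finset.mem_insert]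
  case grp_le =>
    rintro k (rfl | hk)
    · simp
    · simpa only [update_of_notMem hi hk] using h.grp_le k hk
  case rep_mem =>
    rintro k (rfl | hk)
    · rw [hi']; exact Or.inr hrj
    · rw [update_of_notMem hi hk]; exact Or.inr (hnl k hk)
  case rep_rep =>
    rintro k (rfl | hk)
    · rw [hi', update_of_notMem hi hrj, h.rep_rep j hjr]
    · rw [update_of_notMem hi hk, update_of_notMem hi (hnl k hk), h.rep_rep k hk]
  case rep_eq_iff =>
    rintro k l (rfl | hk) (rfl | hl)
    · simp
    · rw [hi', update_of_notMem hi hl, Function.update_self, update_of_notMem hi hl,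
        h.rep_eq_iff j l hjr hl, hjg]
    · rw [hi', update_of_notMem hi hk, Function.update_self, update_of_notMem hi hk,
        h.rep_eq_iff k j hk hjr, hjg]
    · rw [update_of_notMem hi hk, update_of_notMem hi hl, update_of_notMem hi hk,
        update_of_notMem hi hl,
        h.rep_eq_iff k l hk hl]
  case alloc_rep =>
    rintro k (rfl | hk)
    · rw [hi']; exact fun e => absurd e hrji
    · rw [update_of_notMem hi hk, update_of_notMem hi hk]; exact h.alloc_rep k hk
  case alloc_subset =>
    rintro k (rfl | hk)
    · rw [Function.update_self]; exact hT.1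
    · rw [update_of_notMem hi hk]; exact h.alloc_subset k hk
  case rep_lt =>
    rintro k (rfl | hk)
    · rw [hi', Function.update_self, ← hθ]; exact fun _ => hval
    · rw [update_of_notMem hi hk, update_of_notMem hi hk]; exact h.rep_lt k hk
  case tight =>
    rintro k (rfl | hk)
    · rw [hi', Function.update_self, ← hθ]; exact fun _ g hg => hT.sum_base_sdiff_le hg
    · rw [update_of_notMem hi hk, update_of_notMem hi hk]; exact h.tight k hk
  case theta_current =>
    rintro k (rfl | hk)
    · rw [hi']; exact hθ
    · rw [update_of_notMem hi ((h.mem_current k).1 hk).1]; exact h.theta_current k hk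
  case no_edge_to_remaining =>
    rintro k l (rfl | hk) ⟨hl, hl'⟩
    · simp
    · rw [update_of_notMem hi hk, update_of_notMem hi hk]; exact h.no_edge_to_remaining k l hk hl'
  case no_forward_edge =>
    rintro k l (rfl | hk) (rfl | hl)
    · simp
    · rw [Function.update_self, update_of_notMem hi hl]
      exact fun e => absurd (h.grp_le l hl) (not_le.2 e)
    · rw [Function.update_self, update_of_notMem hi hk, update_of_notMem hi hk]
      exact h.no_edge_to_remaining k l hk hi
    · rw [update_of_notMem hi hk, update_of_notMem hi hk, update_of_notMem hi hl]
      exact h.no_forward_edge k l hk hl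
  case mono =>
    rintro k l (rfl | hk) (rfl | hl)
    · simp
    · rw [hi', update_of_notMem hi hl, Function.update_self, update_of_notMem hi hl, ← hjg]
      exact h.mono j l hjr hl
    · rw [hi', update_of_notMem hi hk, Function.update_self, update_of_notMem hi hk, ← hjg]
      exact h.mono k j hk hjr
    · rw [update_of_notMem hi hk, update_of_notMem hi hl, update_of_notMem hi hk,
        update_of_notMem hi hl]
      exact h.mono k l hk hl
  case le_remaining =>
    rintro k l (rfl | hk) ⟨hl, hl'⟩
    · rw [hi']; exact h.le_remaining j l hjr hl'
    · rw [update_of_notMem hi hk]; exact h.le_remaining k l hk hl'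

/-- The exit condition of the inner loop closes the current group: no processed agent has an edge to
a remaining one. Since `r` has minimum value among the remaining agents, the thresholds stay
monotone. -/
lemma ElimInv.newGroup {s : ElimState n G} {ρ : Fin n → Fin n} (h : ElimInv I W s ρ) {r : Fin n}
    (hdone : ∀ j ∈ s.current, ∀ i ∈ s.remaining, I.val j (W i) ≤ s.θ)
    (hr : r ∈ s.remaining) (hmin : ∀ i ∈ s.remaining, I.val r (W r) ≤ I.val i (W i)) :
    ElimInv I W
      { remaining := s.remaining.erase r
        idx := s.idx + 1
        current := {r}
        θ := I.val r (W r)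
        out := ⟨Function.update s.out.alloc r (W r),
                Function.update s.out.grp r (s.idx + 1)⟩ }
      (Function.update ρ r r) := by
  have hmem : ∀ k, k ∉ s.remaining.erase r ↔ k = r ∨ k ∉ s.remaining := by
    intro k; rw [Finset.mem_erase]; tauto
  have hnl := h.rep_mem
  have hclosed : ∀ k l, k ∉ s.remaining → l ∈ s.remaining →
      I.val k (W l) ≤ I.val (ρ k) (W (ρ k)) := by
    intro k l hk hl
    rcases (h.grp_le k hk).lt_or_eq with hlt | heq
    · exact h.no_edge_to_remaining k l hk hl hlt
    · have hc := (h.mem_current k).2 ⟨hk, heq⟩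
      exact h.theta_current k hc ▸ hdone k hc l hl
  constructor
  case mem_current =>
    intro k
    simp only [hmem, Finset.mem_singleton]
    by_cases hk : k = r
    · simp [hk]
    · simp only [hk, false_or, false_iff, not_and, ne_eq, not_false_eq_true,
        Function.update_of_ne]
      intro hk'
      have := h.grp_le k hk'
      omega
  case path =>
    have key : ∀ a b, (a ∉ s.remaining ∧ b ∉ s.remaining ∧
        I.val (ρ a) (W (ρ a)) < I.val a (s.out.alloc b)) →
        (a ∉ s.remaining.erase r ∧ b ∉ s.remaining.erase r ∧
        I.val (Function.update ρ r r a) (W (Function.update ρ r r a)) <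
          I.val a (Function.update s.out.alloc r (W r) b)) := by
      rintro a b ⟨ha, hb, hab⟩
      rw [update_of_notMem hr ha, update_of_notMem hr hb, hmem, hmem]
      exact ⟨Or.inr ha, Or.inr hb, hab⟩
    intro k hk
    rcases (hmem k).1 hk with rfl | hk
    · simp only [Function.update_self]
      exact Relation.ReflTransGen.refl
    · simp only [update_of_notMem hr hk]
      exact Relation.ReflTransGen.mono key _ _ (h.path k hk)
  all_goals
    try simp only [hmem]
    try simp only [Finset.mem_erase, Finset.mem_singleton]
  case grp_le =>
    rintro k (rfl | hk)
    · simp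
    · simpa only [update_of_notMem hr hk] using (h.grp_le k hk).trans (Nat.le_succ _)
  case rep_mem =>
    rintro k (rfl | hk)
    · simp
    · rw [update_of_notMem hr hk]; exact Or.inr (hnl k hk)
  case rep_rep =>
    rintro k (rfl | hk)
    · simp
    · rw [update_of_notMem hr hk, update_of_notMem hr (hnl k hk), h.rep_rep k hk]
  case rep_eq_iff =>
    rintro k l (rfl | hk) (rfl | hl)
    · simp
    · rw [Function.update_self, update_of_notMem hr hl, Function.update_self,
        update_of_notMem hr hl]
      have h₁ := h.grp_le l hl
      exact iff_of_false (fun e => hnl l hl (e ▸ hr)) (by omega)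
    · rw [Function.update_self, update_of_notMem hr hk, Function.update_self,
        update_of_notMem hr hk]
      have h₁ := h.grp_le k hk
      exact iff_of_false (fun e => hnl k hk (e ▸ hr)) (by omega)
    · rw [update_of_notMem hr hk, update_of_notMem hr hl, update_of_notMem hr hk,
        update_of_notMem hr hl,
        h.rep_eq_iff k l hk hl]
  case alloc_rep =>
    rintro k (rfl | hk)
    · simp
    · rw [update_of_notMem hr hk, update_of_notMem hr hk]; exact h.alloc_rep k hk
  case alloc_subset =>
    rintro k (rfl | hk)
    · simp
    · rw [update_of_notMem hr hk]; exact h.alloc_subset k hk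
  case rep_lt =>
    rintro k (rfl | hk)
    · simp
    · rw [update_of_notMem hr hk, update_of_notMem hr hk]; exact h.rep_lt k hk
  case tight =>
    rintro k (rfl | hk)
    · simp
    · rw [update_of_notMem hr hk, update_of_notMem hr hk]; exact h.tight k hk
  case theta_current =>
    rintro k rfl
    simp
  case no_edge_to_remaining =>
    rintro k l (rfl | hk) ⟨hl, hl'⟩
    · simp
    · rw [update_of_notMem hr hk, update_of_notMem hr hk]; exact fun _ => hclosed k l hk hl'
  case no_forward_edge =>
    rintro k l (rfl | hk) (rfl | hl)
    · simp
    · rw [Function.update_self, update_of_notMem hr hl]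
      have h₁ := h.grp_le l hl
      exact fun e => absurd e (by omega)
    · rw [Function.update_self, update_of_notMem hr hk, update_of_notMem hr hk]
      exact fun _ => hclosed k l hk hr
    · rw [update_of_notMem hr hk, update_of_notMem hr hk, update_of_notMem hr hl]
      exact h.no_forward_edge k l hk hl
  case mono =>
    rintro k l (rfl | hk) (rfl | hl)
    · simp
    · rw [Function.update_self, update_of_notMem hr hl, Function.update_self,
        update_of_notMem hr hl]
      have h₁ := h.grp_le l hl
      exact fun e => absurd e (by omega)
    · rw [update_of_notMem hr hk, Function.update_self, update_of_notMem hr hk,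
        Function.update_self]
      exact fun _ => h.le_remaining k l hk hr
    · rw [update_of_notMem hr hk, update_of_notMem hr hl, update_of_notMem hr hk,
        update_of_notMem hr hl]
      exact h.mono k l hk hl
  case le_remaining =>
    rintro k l (rfl | hk) ⟨hl, hl'⟩
    · rw [Function.update_self]; exact hmin l hl'
    · rw [update_of_notMem hr hk]; exact h.le_remaining k l hk hl'

lemma exists_elimInv (hW : ∀ i, ∀ g ∈ W i, I.val i {g} = I.base g) {s : ElimState n G}
    (h : Relation.ReflTransGen (ElimStep I W) elimStart s) : ∃ ρ, ElimInv I W s ρ := by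
  induction h with
  | refl => exact ⟨id, elimInv_start⟩
  | tail _ hstep ih =>
    obtain ⟨ρ, hρ⟩ := ih
    cases hstep with
    | join i j T hj hi _ hT => exact ⟨_, hρ.join hW hj hi hT⟩
    | newGroup r hdone hr hmin => exact ⟨_, hρ.newGroup hdone hr hmin⟩

omit [DecidableEq G] in
lemma exists_envyElimination (I : RestrictedAdditiveInstance n G) (X : Fin n → Finset G) :
    ∃ σ', EnvyElimination I X σ' := by
  obtain ⟨s, hs, he⟩ := exists_elimSteps I (removeWaste I X) _ elimStart rfl
  exact ⟨s.out, s, hs, he, rfl⟩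

end Elimination

/-! ### Envy-elimination restores the invariant -/

section Invariant

variable [DecidableEq G]

/-- The properties shared by all configurations that the algorithm reaches. -/
structure Invariant (I : RestrictedAdditiveInstance n G) (σ : Config n G) : Prop where
  isAllocation : IsAllocation σ.alloc
  proper : Proper I σ
  rep_unique : ∀ i j, IsRep I σ i → IsRep I σ j → σ.grp i = σ.grp j → i = j
  no_edge_to_rep : ∀ i r, IsRep I σ r → I.val i (σ.alloc r) ≤ repValue I σ i

variable {I : RestrictedAdditiveInstance n G}

/-- The second hypothesis serves empty bundles, where `min 1 0 = 0` forces the removed set to be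
empty. -/
lemma isEFX_of_forall {v : Fin n → Finset G → ℝ} {X : Fin n → Finset G}
    (h₁ : ∀ i j, i ≠ j → ∀ g ∈ X j, v i (X j \ {g}) ≤ v i (X i))
    (h₂ : ∀ i, v i ∅ ≤ v i (X i)) : IsEFX v X := by
  intro i j hij T hT hcard
  rcases (X j).eq_empty_or_nonempty with he | hne
  · simpa [he] using h₂ i
  · rw [Nat.min_eq_left (Finset.card_pos.2 hne)] at hcard
    obtain ⟨g, rfl⟩ := Finset.card_eq_one.1 hcard
    exact h₁ i j hij g (by simpa using hT)

omit [DecidableEq G] in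
lemma removeWaste_subset (I : RestrictedAdditiveInstance n G) (X : Fin n → Finset G) (i : Fin n) :
    removeWaste I X i ⊆ X i := Finset.filter_subset _ _

omit [DecidableEq G] in
lemma val_removeWaste (I : RestrictedAdditiveInstance n G) (X : Fin n → Finset G) (i : Fin n) :
    I.val i (removeWaste I X i) = I.val i (X i) := by
  rw [I.additive i (X i), I.additive i (removeWaste I X i)]
  exact Finset.sum_filter_ne_zero _

omit [DecidableEq G] in
lemma val_eq_base_of_mem_removeWaste {X : Fin n → Finset G} {i : Fin n} {g : G}
    (hg : g ∈ removeWaste I X i) : I.val i {g} = I.base g :=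
  (I.restricted i g).resolve_left (Finset.mem_filter.1 hg).2

omit [DecidableEq G] in
lemma removeWaste_eq_self {X : Fin n → Finset G} {i : Fin n}
    (h : I.val i (X i) = ∑ g ∈ X i, I.base g) : removeWaste I X i = X i := by
  rw [I.additive] at h
  have h₁ := (Finset.sum_eq_sum_iff_of_le fun g _ => I.val_singleton_le_base i g).1 h
  exact Finset.filter_true_of_mem fun g hg => (h₁ g hg).trans_ne (I.base_pos g).ne'

variable {W : Fin n → Finset G} {s : ElimState n G} {ρ : Fin n → Fin n}

lemma ElimInv.grp_rep (h : ElimInv I W s ρ) (hs : s.remaining = ∅) (i : Fin n) :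
    s.out.grp (ρ i) = s.out.grp i := by
  rw [← h.rep_eq_iff _ _ (by simp [hs]) (by simp [hs]), h.rep_rep i (by simp [hs])]

lemma ElimInv.repValue_eq (h : ElimInv I W s ρ) (hs : s.remaining = ∅) (i : Fin n) :
    repValue I s.out i = I.val (ρ i) (W (ρ i)) := by
  have hn : ∀ k, k ∉ s.remaining := by simp [hs]
  have hr := h.alloc_rep (ρ i) (hn _) (h.rep_rep i (hn _))
  rw [FairDivision.repValue_eq I s.out (h.grp_rep hs i), hr]
  intro j hj
  rw [hr, ← (h.rep_eq_iff j i (hn _) (hn _)).2 hj]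
  by_cases hjj : ρ j = j
  · rw [hjj, h.alloc_rep j (hn _) hjj]
  · exact (h.rep_lt j (hn _) hjj).le

lemma ElimInv.isRep_iff (h : ElimInv I W s ρ) (hs : s.remaining = ∅) (i : Fin n) :
    IsRep I s.out i ↔ ρ i = i := by
  rw [IsRep, h.repValue_eq hs]
  constructor
  · intro h₁
    by_contra hne
    exact (h.rep_lt i (by simp [hs]) hne).ne' h₁
  · intro h₁
    rw [h.alloc_rep i (by simp [hs]) h₁, h₁]

/-- Compare the groups of the evaluating agent `k` and the owner `i`. If `k` comes earlier, even the
uncut bundle `W i` creates no edge. Otherwise the threshold of `k` is at least that of `i`, which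
bounds the inherent value of a representative's bundle, and of any other bundle minus one good. -/
lemma ElimInv.invariant (h : ElimInv I W s ρ) (hs : s.remaining = ∅)
    (hW : ∀ i, ∀ g ∈ W i, I.val i {g} = I.base g) (hd : IsAllocation W) : Invariant I s.out := by
  have hn : ∀ k, k ∉ s.remaining := by simp [hs]
  have hθ := h.repValue_eq hs
  have hrep := h.isRep_iff hs
  have hle : ∀ k i, I.val k (s.out.alloc i) ≤ I.val k (W i) := fun k i =>
    I.val_mono k (h.alloc_subset i (hn i))
  have hedge : ∀ k r, IsRep I s.out r → I.val k (s.out.alloc r) ≤ repValue I s.out k := by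
    intro k r hr
    rw [hθ]
    rcases lt_or_ge (s.out.grp k) (s.out.grp r) with hlt | hge
    · exact (hle k r).trans (h.no_forward_edge k r (hn _) (hn _) hlt)
    · have h₁ := h.mono r k (hn _) (hn _) hge
      rw [(hrep r).1 hr] at h₁
      refine ((hle k r).trans ((I.val_le_sum_base k _).trans_eq ?_)).trans h₁
      exact (I.val_eq_sum_base (hW r)).symm
  have htight : ∀ k i, ∀ g ∈ s.out.alloc i,
      I.val k (s.out.alloc i \ {g}) ≤ repValue I s.out k := by
    intro k i g hg
    by_cases hi : ρ i = i
    · exact (I.val_mono k Finset.sdiff_subset).trans (hedge k i ((hrep i).2 hi))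
    · rw [hθ]
      rcases lt_or_ge (s.out.grp k) (s.out.grp i) with hlt | hge
      · exact (I.val_mono k Finset.sdiff_subset).trans
          ((hle k i).trans (h.no_forward_edge k i (hn _) (hn _) hlt))
      · exact (I.val_le_sum_base k _).trans
          ((h.tight i (hn _) hi g hg).trans (h.mono i k (hn _) (hn _) hge))
  refine ⟨?_, ⟨?_, ?_, ⟨?_, ?_, ?_⟩⟩, ?_, hedge⟩
  · exact fun i j hij => Finset.disjoint_of_subset_left (h.alloc_subset i (hn i))
      (Finset.disjoint_of_subset_right (h.alloc_subset j (hn j)) (hd i j hij))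
  · exact isEFX_of_forall
      (fun i j _ g hg => (htight i j g hg).trans (repValue_le_self I _ i))
      (fun i => I.val_mono i (Finset.empty_subset _))
  · exact fun i g hg => htight i i g hg
  · intro r i hr hri
    have h₁ : ρ i = r := by
      rw [← (h.rep_eq_iff r i (hn _) (hn _)).2 hri, (hrep r).1 hr]
    have h₂ := h.path i (hn i)
    rw [h₁] at h₂
    refine Relation.ReflTransGen.mono ?_ _ _ h₂
    rintro a b ⟨-, -, hab⟩
    rwa [RegularEdge, hθ]
  · intro i j hij
    rw [hθ]
    exact (hle i j).trans (h.no_forward_edge i j (hn _) (hn _) hij)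
  · exact fun i _ => I.val_eq_sum_base fun g hg => hW i g (h.alloc_subset i (hn i) hg)
  · intro i j hi hj hij
    rw [← (hrep i).1 hi, ← (hrep j).1 hj, h.rep_eq_iff i j (hn _) (hn _)]
    exact hij

variable {X : Fin n → Finset G} {σ σ' : Config n G}

lemma EnvyElimination.exists_elimInv (h : EnvyElimination I X σ') :
    ∃ s ρ, ElimInv I (removeWaste I X) s ρ ∧ s.remaining = ∅ ∧ s.out = σ' := by
  obtain ⟨s, hs, he, hout⟩ := h
  obtain ⟨ρ, hρ⟩ := FairDivision.exists_elimInv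
    (fun i g hg => val_eq_base_of_mem_removeWaste hg) hs
  exact ⟨s, ρ, hρ, he, hout⟩

lemma EnvyElimination.invariant (h : EnvyElimination I X σ') (hX : IsAllocation X) :
    Invariant I σ' := by
  obtain ⟨s, ρ, hρ, he, rfl⟩ := h.exists_elimInv
  refine hρ.invariant he (fun i g hg => val_eq_base_of_mem_removeWaste hg) fun i j hij => ?_
  exact Finset.disjoint_of_subset_left (removeWaste_subset I X i)
    (Finset.disjoint_of_subset_right (removeWaste_subset I X j) (hX i j hij))

lemma EnvyElimination.val_rep (h : EnvyElimination I X σ') {r : Fin n} (hr : IsRep I σ' r) :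
    I.val r (X r) = repValue I σ' r := by
  obtain ⟨s, ρ, hρ, he, rfl⟩ := h.exists_elimInv
  rw [← val_removeWaste, hρ.repValue_eq he, (hρ.isRep_iff he r).1 hr]

/-- Were the threshold of `j` larger, `j` would sit in a later group, and forward edges are absent
even towards bundles before cutting. -/
lemma EnvyElimination.repValue_le_of_envy (h : EnvyElimination I X σ') {i j : Fin n}
    (hij : repValue I σ' i < I.val i (removeWaste I X j)) : repValue I σ' j ≤ repValue I σ' i := by
  obtain ⟨s, ρ, hρ, he, rfl⟩ := h.exists_elimInv
  rw [hρ.repValue_eq he] at hij ⊢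
  rw [hρ.repValue_eq he]
  refine hρ.mono j i (by simp [he]) (by simp [he]) (not_lt.1 fun hlt => ?_)
  exact hij.not_ge (hρ.no_forward_edge i j (by simp [he]) (by simp [he]) hlt)

lemma Invariant.grp_le_of_edge (hσ : Invariant I σ) {i j : Fin n} (h : RegularEdge I σ i j) :
    σ.grp j ≤ σ.grp i :=
  not_lt.1 fun hlt => h.not_ge (hσ.proper.2.2.no_forward_edge i j hlt)

lemma Invariant.grp_le_of_path (hσ : Invariant I σ) {i j : Fin n}
    (h : Relation.ReflTransGen (RegularEdge I σ) i j) : σ.grp j ≤ σ.grp i := by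
  induction h with
  | refl => exact le_rfl
  | tail _ h ih => exact (hσ.grp_le_of_edge h).trans ih

lemma invariant_initial : Invariant I (initial : Config n G) := by
  have hv : ∀ i, I.val i ∅ = 0 := fun i => by rw [I.additive]; simp
  have hθ : ∀ i, repValue I (initial : Config n G) i = 0 := by
    intro i
    rw [repValue_eq I _ (i := i) (r := i) rfl] <;> simp [initial, hv]
  refine ⟨?_, ⟨?_, ?_, ⟨?_, ?_, ?_⟩⟩, ?_, ?_⟩
  · intro i j _; simp [initial]
  · exact isEFX_of_forall (by simp [initial]) (by simp [initial])
  · intro i g hg; simp [initial] at hg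
  · intro r i _ h
    have : r = i := by simpa [initial, Fin.ext_iff] using h
    exact this ▸ .refl
  · intro i j _; rw [hθ]; simp [initial, hv]
  · intro i _; simp [initial, hv]
  · intro i j _ _ h; simpa [initial, Fin.ext_iff] using h
  · intro i j _; rw [hθ]; simp [initial, hv]

end Invariant

/-! ### The potential and its decrease -/

section Potential

variable [Fintype G] [DecidableEq G]

/-- All values that bundles can have. -/
noncomputable def valueSet (I : RestrictedAdditiveInstance n G) : Finset ℝ :=
  Finset.univ.image fun p : Fin n × Finset G => I.val p.1 p.2

omit [DecidableEq G] in
lemma repValue_mem_valueSet (I : RestrictedAdditiveInstance n G) (σ : Config n G) (i : Fin n) :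
    repValue I σ i ∈ valueSet I := by
  obtain ⟨r, hr, hri⟩ := exists_isRep I σ i
  rw [← repValue_congr I σ hri, ← hr]
  exact Finset.mem_image.2 ⟨(r, σ.alloc r), Finset.mem_univ _, rfl⟩

open scoped Classical in
/-- The representatives whose bundles have value `t`. -/
noncomputable def repsAt (I : RestrictedAdditiveInstance n G) (σ : Config n G) (t : ℝ) :
    Finset (Fin n) :=
  Finset.univ.filter fun i => IsRep I σ i ∧ repValue I σ i = t

open scoped Classical in
/-- The agents whose representatives have bundles of value `t`. -/
noncomputable def agentsAt (I : RestrictedAdditiveInstance n G) (σ : Config n G) (t : ℝ) :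
    Finset (Fin n) :=
  Finset.univ.filter fun i => repValue I σ i = t

omit [Fintype G] [DecidableEq G] in
lemma mem_repsAt {I : RestrictedAdditiveInstance n G} {σ : Config n G} {t : ℝ} {i : Fin n} :
    i ∈ repsAt I σ t ↔ IsRep I σ i ∧ repValue I σ i = t := by simp [repsAt]

omit [Fintype G] [DecidableEq G] in
lemma mem_agentsAt {I : RestrictedAdditiveInstance n G} {σ : Config n G} {t : ℝ} {i : Fin n} :
    i ∈ agentsAt I σ t ↔ repValue I σ i = t := by simp [agentsAt]

/-- The weight of a value `t`: it encodes lexicographically the number of representatives with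
value `t` and the number of agents outside their groups. -/
noncomputable def weight (I : RestrictedAdditiveInstance n G) (σ : Config n G) (t : valueSet I) :
    ℕ :=
  (repsAt I σ t).card * (n + 1) + (n - (agentsAt I σ t).card)

/-- The lexicographic order on weight functions, smallest value first. -/
def WeightLT (I : RestrictedAdditiveInstance n G) (w w' : valueSet I → ℕ) : Prop :=
  Pi.Lex (· < ·) (fun {_} a b => a < b) w w'

omit [DecidableEq G] in
lemma wellFounded_weightLT (I : RestrictedAdditiveInstance n G) : WellFounded (WeightLT I) :=
  Pi.Lex.wellFounded _ fun _ => wellFounded_lt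

variable {I : RestrictedAdditiveInstance n G} {σ σ' : Config n G} {Y : Fin n → Finset G}

/-- `C` is the set of agents whose bundles may change. If the weight did not drop, then, by
induction on values up to the least old threshold met by `C`, the representatives and the agents at
each value would be the same before and after, with no such representative in `C`. At the least
threshold itself this contradicts the fact that `C` contains a representative there. -/
theorem EnvyElimination.weightLT (h : EnvyElimination I Y σ') (hσ : Invariant I σ)
    {C : Set (Fin n)} (hC : C.Nonempty) (hlt : ∀ i ∈ C, repValue I σ i < I.val i (Y i))
    (heq : ∀ i ∉ C, Y i = σ.alloc i)
    (hrep : ∀ i ∈ C, ∃ r ∈ C, σ.grp r = σ.grp i ∧ IsRep I σ r) :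
    WeightLT I (weight I σ') (weight I σ) := by
  by_contra hno
  obtain ⟨c, hc, hmin⟩ := Set.exists_min_image C (repValue I σ) C.toFinite hC
  have key : ∀ t : valueSet I, (t : ℝ) ≤ repValue I σ c →
      repsAt I σ' t = repsAt I σ t ∧ agentsAt I σ' t = agentsAt I σ t ∧
        ∀ r ∈ repsAt I σ' t, r ∉ C := by
    intro t
    induction t using WellFoundedLT.induction with
    | ind t ih =>
      intro ht
      have hw : weight I σ t ≤ weight I σ' t := by
        by_contra! hlt'
        refine hno ⟨t, fun s hs => ?_, hlt'⟩
        have := ih s hs ((Subtype.coe_lt_coe.2 hs).le.trans ht)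
        simp only [weight, this]
      -- Agents of `C` now hold more than the least threshold of `C`, hence more than `t`.
      have hnotC : ∀ r ∈ repsAt I σ' t, r ∉ C := by
        intro r hr hrC
        rw [mem_repsAt] at hr
        have h₁ := hlt r hrC
        rw [h.val_rep hr.1, hr.2] at h₁
        exact (hmin r hrC).not_gt (h₁.trans_le ht)
      have hsub : repsAt I σ' t ⊆ repsAt I σ t := by
        intro r hr
        have hrC := hnotC r hr
        rw [mem_repsAt] at hr
        have h₁ : I.val r (σ.alloc r) = t := by
          rw [← heq r hrC, h.val_rep hr.1, hr.2]
        have h₂ : repValue I σ r = t := by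
          -- A smaller old threshold would, by the induction hypothesis, also be the new threshold
          -- of `r`, which is `t`.
          refine le_antisymm ((repValue_le_self I σ r).trans_eq h₁) (not_lt.1 fun hlt' => ?_)
          have h₃ := (ih ⟨_, repValue_mem_valueSet I σ r⟩ hlt' (hlt'.le.trans ht)).2.1
          have h₄ : r ∈ agentsAt I σ (repValue I σ r) := mem_agentsAt.2 rfl
          rw [← h₃, mem_agentsAt, hr.2] at h₄
          exact hlt'.ne' h₄
        exact mem_repsAt.2 ⟨h₁.trans h₂.symm, h₂⟩
      have hcard := Finset.card_le_card hsub
      have hreps : repsAt I σ' t = repsAt I σ t := by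
        refine Finset.eq_of_subset_of_card_le hsub (not_lt.1 fun hlt' => ?_)
        -- One representative fewer outweighs any change in the second term of the weight, which is
        -- at most `n`.
        have h₁ : (repsAt I σ' t).card * (n + 1) + (n + 1) ≤ (repsAt I σ t).card * (n + 1) := by
          rw [← Nat.succ_mul]
          exact Nat.mul_le_mul_right _ hlt'
        simp only [weight] at hw
        omega
      have hagents : agentsAt I σ t ⊆ agentsAt I σ' t := by
        intro i hi
        obtain ⟨r, hr, hri⟩ := exists_isRep I σ i
        have hpath := hσ.proper.2.2.path r i hr hri
        rw [mem_agentsAt] at hi ⊢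
        have hrep' : ∀ k, IsRep I σ k → repValue I σ k = t → k ∉ C ∧ repValue I σ' k = t := by
          intro k hk hkt
          have h₁ : k ∈ repsAt I σ' t := hreps ▸ mem_repsAt.2 ⟨hk, hkt⟩
          exact ⟨hnotC k h₁, (mem_repsAt.1 h₁).2⟩
        have hrt : repValue I σ r = t := (repValue_congr I σ hri).trans hi
        -- Edges never increase the group index, so a path from `r` back to the group of `r` stays
        -- inside it; the new threshold `t` propagates along it.
        have hall : ∀ k, Relation.ReflTransGen (RegularEdge I σ) r k → σ.grp r ≤ σ.grp k →
            repValue I σ' k = t := by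
          intro k hk
          induction hk with
          | refl => exact fun _ => (hrep' r hr hrt).2
          | @tail a b hra hab iha =>
            intro hle
            have hab' := hσ.grp_le_of_edge hab
            have hra' := hσ.grp_le_of_path hra
            have hgb : σ.grp b = σ.grp r := le_antisymm (hab'.trans hra') hle
            have hga : σ.grp a = σ.grp r := le_antisymm hra' (hle.trans hab')
            have ha := iha hga.ge
            have hbt : repValue I σ b = t := (repValue_congr I σ hgb).trans hrt
            by_cases hb : IsRep I σ b
            · exact (hrep' b hb hbt).2
            · have hbC : b ∉ C := by
                intro hbC
                obtain ⟨q, hqC, hqb, hq⟩ := hrep b hbC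
                exact (hrep' q hq ((repValue_congr I σ hqb).trans hbt)).1 hqC
              -- The bundle of `b` is untouched and waste-free, so the edge from `a` to `b` is still
              -- present when envy-elimination starts.
              have hWb : removeWaste I Y b = σ.alloc b := by
                rw [← heq b hbC]
                refine removeWaste_eq_self ?_
                rw [heq b hbC]
                exact hσ.proper.2.2.nonwasteful b hb
              have h₁ : repValue I σ' b ≤ repValue I σ' a := by
                refine h.repValue_le_of_envy ?_
                rw [hWb, ha, ← (repValue_congr I σ hga).trans hrt]
                exact hab
              refine le_antisymm (h₁.trans_eq ha) (not_lt.1 fun hlt' => ?_)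
              have h₃ := (ih ⟨_, repValue_mem_valueSet I σ' b⟩ hlt' (hlt'.le.trans ht)).2.1
              have h₄ : b ∈ agentsAt I σ' (repValue I σ' b) := mem_agentsAt.2 rfl
              rw [h₃, mem_agentsAt, hbt] at h₄
              exact hlt'.ne' h₄
        exact hall i hpath hri.le
      refine ⟨hreps, (Finset.eq_of_subset_of_card_le hagents ?_).symm, hnotC⟩
      have h₁ : (agentsAt I σ' t).card ≤ n := (Finset.card_le_univ _).trans_eq (by simp)
      simp only [weight, hreps] at hw
      have h₂ := Finset.card_le_card hagents
      have h₃ : (agentsAt I σ t).card ≤ n := (Finset.card_le_univ _).trans_eq (by simp)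
      omega
  obtain ⟨r, hrC, hrc, hr⟩ := hrep c hc
  obtain ⟨h₁, -, h₂⟩ := key ⟨_, repValue_mem_valueSet I σ c⟩ le_rfl
  exact h₂ r (h₁ ▸ mem_repsAt.2 ⟨hr, repValue_congr I σ hrc⟩) hrC

end Potential

variable {n : ℕ} {G : Type*} [Fintype G] [DecidableEq G]

/-! ### Each rule preserves the invariant and makes progress -/

section Rules

variable {I : RestrictedAdditiveInstance n G} {ch : Config n G → Finset G → Fin n → Finset G}
  {σ σ' : Config n G}

lemma mem_pool {X : Fin n → Finset G} {g : G} : g ∈ pool X ↔ ∀ i, g ∉ X i := by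
  simp [pool]

omit [Fintype G] [DecidableEq G] in
lemma IsAllocation.eq_of_mem {X : Fin n → Finset G} (hX : IsAllocation X) {i j : Fin n} {g : G}
    (hi : g ∈ X i) (hj : g ∈ X j) : i = j := by
  by_contra hij
  exact Finset.disjoint_left.1 (hX i j hij) hi hj

omit [Fintype G] [DecidableEq G] in
lemma isAllocation_of_eq_of_mem {X : Fin n → Finset G}
    (h : ∀ i j, ∀ g ∈ X i, g ∈ X j → i = j) : IsAllocation X := fun i j hij =>
  Finset.disjoint_left.2 fun g hi hj => hij (h i j g hi hj)

/-- Bundles that are moved by an injective map and extended by disjoint parts of the pool form an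
allocation. -/
lemma IsAllocation.of_shift {X Y : Fin n → Finset G} (hX : IsAllocation X)
    (src : Fin n → Fin n) (hsrc : Function.Injective src) (L : Fin n → Finset G)
    (hL : ∀ i, L i ⊆ pool X) (hLd : ∀ i j, ∀ g ∈ L i, g ∈ L j → i = j)
    (hY : ∀ i, Y i ⊆ X (src i) ∪ L i) : IsAllocation Y := by
  refine isAllocation_of_eq_of_mem fun i j g hi hj => ?_
  rcases Finset.mem_union.1 (hY i hi) with hi | hi <;>
    rcases Finset.mem_union.1 (hY j hj) with hj | hj
  · exact hsrc (hX.eq_of_mem hi hj)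
  · exact absurd hi (mem_pool.1 (hL j hj) _)
  · exact absurd hj (mem_pool.1 (hL i hi) _)
  · exact hLd i j g hi hj

omit [Fintype G] [DecidableEq G] in
lemma repValue_update_of_val_eq {r : Fin n} {S : Finset G}
    (h : I.val r S = I.val r (σ.alloc r)) (i : Fin n) :
    repValue I ⟨Function.update σ.alloc r S, σ.grp⟩ i = repValue I σ i := by
  have : (fun j => I.val j (Function.update σ.alloc r S j)) = fun j => I.val j (σ.alloc j) := by
    funext j
    by_cases hj : j = r
    · subst hj; simpa using h
    · rw [Function.update_of_ne hj]
  simp only [repValue, this]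

lemma U0Pre.repValue_eq {g : G} {r : Fin n} (h : U0Pre I σ g r) (i : Fin n) :
    repValue I ⟨Function.update σ.alloc r (σ.alloc r ∪ {g}), σ.grp⟩ i = repValue I σ i := by
  refine repValue_update_of_val_eq ?_ i
  rw [I.val_union_singleton r (mem_pool.1 h.2.1 r), h.2.2.2.1, add_zero]

lemma U0Pre.isRep_iff {g : G} {r : Fin n} (h : U0Pre I σ g r) (i : Fin n) :
    IsRep I ⟨Function.update σ.alloc r (σ.alloc r ∪ {g}), σ.grp⟩ i ↔ IsRep I σ i := by
  rw [IsRep, IsRep, h.repValue_eq]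
  by_cases hi : i = r
  · subst hi
    dsimp only
    rw [Function.update_self, I.val_union_singleton i (mem_pool.1 h.2.1 i), h.2.2.2.1, add_zero]
  · simp [hi]

/-- The good is worthless to `r`, so no threshold moves; by the precondition the enlarged bundle
exceeds nobody's threshold, so no edge into `r` appears. -/
lemma U0.invariant (h : U0 I σ σ') (hσ : Invariant I σ) : Invariant I σ' := by
  obtain ⟨g, r, hpre, rfl⟩ := h
  have hθ := hpre.repValue_eq
  have hrep := hpre.isRep_iff
  obtain ⟨hproper, hg, hr, hg0, henvy⟩ := hpre
  have hsup : ∀ i, σ.alloc i ⊆ Function.update σ.alloc r (σ.alloc r ∪ {g}) i := by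
    intro i
    by_cases hi : i = r
    · subst hi; simp
    · simp [hi]
  have htight : ∀ i j, (∀ x ∈ σ.alloc j, I.val i (σ.alloc j \ {x}) ≤ I.val i (σ.alloc i)) →
      ∀ x ∈ Function.update σ.alloc r (σ.alloc r ∪ {g}) j,
      I.val i (Function.update σ.alloc r (σ.alloc r ∪ {g}) j \ {x}) ≤ I.val i (σ.alloc i) := by
    intro i j hij x hx
    by_cases hj : j = r
    · subst hj
      rw [Function.update_self]
      exact (I.val_mono i Finset.sdiff_subset).trans ((henvy i).trans (repValue_le_self I σ i))
    · rw [Function.update_of_ne hj] at hx ⊢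
      exact hij x hx
  refine ⟨?_, ⟨?_, ?_, ⟨?_, ?_, ?_⟩⟩, ?_, ?_⟩
  · refine hσ.isAllocation.of_shift id Function.injective_id
      (fun i => if i = r then {g} else ∅) ?_ ?_ ?_
    · intro i
      split_ifs <;> simp [hg]
    · intro i j x hi hj
      split_ifs at hi hj <;> simp_all
    · intro i
      by_cases hi : i = r <;> simp [hi]
  · refine isEFX_of_forall (fun i j hij x hx => ?_) fun i => I.val_mono i (Finset.empty_subset _)
    refine (htight i j (fun y hy => ?_) x hx).trans (I.val_mono i (hsup i))
    refine hproper.1 i j hij {y} (by simpa using hy) ?_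
    rw [Finset.card_singleton, Nat.min_eq_left (Finset.card_pos.2 ⟨y, hy⟩)]
  · intro i x hx
    rw [hθ]
    dsimp only at hx ⊢
    by_cases hi : i = r
    · subst hi
      rw [Function.update_self]
      exact (I.val_mono i Finset.sdiff_subset).trans (henvy i)
    · rw [Function.update_of_ne hi] at hx ⊢
      exact hproper.2.1 i x hx
  · intro q i hq hqi
    refine Relation.ReflTransGen.mono ?_ _ _ (hproper.2.2.path q i ((hrep q).1 hq) hqi)
    intro a b hab
    rw [RegularEdge, hθ]
    exact lt_of_lt_of_le hab (I.val_mono a (hsup b))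
  · intro i j hij
    rw [hθ]
    dsimp only
    by_cases hj : j = r
    · subst hj; simpa using henvy i
    · simpa [hj] using hproper.2.2.no_forward_edge i j hij
  · intro i hi
    rw [hrep] at hi
    have hir : i ≠ r := fun e => hi (e ▸ hr)
    simpa [hir] using hproper.2.2.nonwasteful i hi
  · exact fun i j hi hj => hσ.rep_unique i j ((hrep i).1 hi) ((hrep j).1 hj)
  · intro i q hq
    rw [hθ]
    dsimp only
    by_cases hqr : q = r
    · subst hqr; simpa using henvy i
    · simpa [hqr] using hσ.no_edge_to_rep i q ((hrep q).1 hq)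

lemma U0.weight_eq (h : U0 I σ σ') : weight I σ' = weight I σ := by
  obtain ⟨g, r, hpre, rfl⟩ := h
  have h₁ : ∀ t, repsAt I ⟨Function.update σ.alloc r (σ.alloc r ∪ {g}), σ.grp⟩ t = repsAt I σ t := by
    intro t
    ext i
    rw [mem_repsAt, mem_repsAt, hpre.repValue_eq, hpre.isRep_iff]
  have h₂ : ∀ t,
      agentsAt I ⟨Function.update σ.alloc r (σ.alloc r ∪ {g}), σ.grp⟩ t = agentsAt I σ t := by
    intro t
    ext i
    rw [mem_agentsAt, mem_agentsAt, hpre.repValue_eq]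
  funext t
  simp only [weight, h₁, h₂]

lemma U0.card_pool_lt (h : U0 I σ σ') : (pool σ'.alloc).card < (pool σ.alloc).card := by
  obtain ⟨g, r, hpre, rfl⟩ := h
  refine Finset.card_lt_card (Finset.ssubset_iff_subset_ne.2 ⟨fun x hx => ?_, fun e => ?_⟩)
  · rw [mem_pool] at hx ⊢
    intro i hi
    have h₁ := hx i
    by_cases hir : i = r
    · subst hir; simp [hi] at h₁
    · simp [hir, hi] at h₁
  · have h₁ := hpre.2.1
    rw [← e, mem_pool] at h₁
    simpa using h₁ r

lemma IsChampionCycle.repValue_lt (hch : IsChampChoice I ch) {m : ℕ} {c : Fin (m + 1) → Fin n}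
    {lab : Fin (m + 1) → Option G} (hc : IsChampionCycle I ch σ c lab) {Y : Fin n → Finset G}
    (h₁ : ∀ t, lab t = none → Y (c t) = σ.alloc (c (t + 1)))
    (h₂ : ∀ t g, lab t = some g → Y (c t) = ch σ (σ.alloc (c (t + 1)) ∪ {g}) (c t))
    (t : Fin (m + 1)) : repValue I σ (c t) < I.val (c t) (Y (c t)) := by
  cases hl : lab t with
  | none => rw [h₁ t hl]; exact hc.regular t hl
  | some g => rw [h₂ t g hl]; exact (hch σ _ _ (hc.champion t g hl).2.1).2.1

lemma IsChampionCycle.isAllocation (hch : IsChampChoice I ch) (hσ : IsAllocation σ.alloc) {m : ℕ}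
    {c : Fin (m + 1) → Fin n} {lab : Fin (m + 1) → Option G} (hc : IsChampionCycle I ch σ c lab)
    {Y : Fin n → Finset G}
    (h₁ : ∀ t, lab t = none → Y (c t) = σ.alloc (c (t + 1)))
    (h₂ : ∀ t g, lab t = some g → Y (c t) = ch σ (σ.alloc (c (t + 1)) ∪ {g}) (c t))
    (h₃ : ∀ j, (∀ t, c t ≠ j) → Y j = σ.alloc j) : IsAllocation Y := by
  classical
  -- Every new bundle lies in an old bundle, taken from the successor on the cycle, plus at most one
  -- labelled pool good.
  have hsrc : ∃ src : Fin n → Fin n,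
      (∀ t, src (c t) = c (t + 1)) ∧ ∀ j, (∀ t, c t ≠ j) → src j = j :=
    ⟨Function.extend c (fun t => c (t + 1)) id, fun t => hc.injective.extend_apply _ _ t,
      fun j hj => Function.extend_apply' _ _ j (by simpa using hj)⟩
  have hL : ∃ L : Fin n → Finset G, (∀ t, L (c t) = (lab t).toFinset) ∧
      ∀ j, (∀ t, c t ≠ j) → L j = ∅ :=
    ⟨Function.extend c (fun t => (lab t).toFinset) fun _ => ∅,
      fun t => hc.injective.extend_apply _ _ t,
      fun j hj => Function.extend_apply' _ _ j (by simpa using hj)⟩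
  obtain ⟨src, hs₁, hs₂⟩ := hsrc
  obtain ⟨L, hL₁, hL₂⟩ := hL
  have hcase : ∀ j, (∃ t, c t = j) ∨ ∀ t, c t ≠ j := fun j => by
    by_cases h : ∃ t, c t = j
    · exact Or.inl h
    · exact Or.inr (by push Not at h; exact h)
  refine hσ.of_shift src ?_ L ?_ ?_ ?_
  · intro i j hij
    rcases hcase i with ⟨t, rfl⟩ | hi <;> rcases hcase j with ⟨u, rfl⟩ | hj
    · rw [hs₁, hs₁] at hij
      rw [add_right_cancel (hc.injective hij)]
    · rw [hs₁, hs₂ j hj] at hij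
      exact absurd hij (hj _)
    · rw [hs₁, hs₂ i hi] at hij
      exact absurd hij.symm (hi _)
    · rwa [hs₂ i hi, hs₂ j hj] at hij
  · intro i g hg
    rcases hcase i with ⟨t, rfl⟩ | hi
    · rw [hL₁, Option.mem_toFinset] at hg
      exact (hc.champion t g hg).1
    · simp [hL₂ i hi] at hg
  · intro i j g hi hj
    rcases hcase i with ⟨t, rfl⟩ | hi'
    · rcases hcase j with ⟨u, rfl⟩ | hj'
      · rw [hL₁, Option.mem_toFinset] at hi hj
        rw [hc.labels_distinct t u g hi hj]
      · simp [hL₂ j hj'] at hj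
    · simp [hL₂ i hi'] at hi
  · intro i
    rcases hcase i with ⟨t, rfl⟩ | hi
    · rw [hs₁, hL₁]
      cases hl : lab t with
      | none => simp [h₁ t hl]
      | some g =>
        rw [h₂ t g hl]
        simpa using (hch σ _ _ (hc.champion t g hl).2.1).1
    · rw [h₃ i hi, hs₂ i hi]
      exact Finset.subset_union_left

lemma U1.invariant_and_weightLT (hch : IsChampChoice I ch) (h : U1 I ch σ σ')
    (hσ : Invariant I σ) : Invariant I σ' ∧ WeightLT I (weight I σ') (weight I σ) := by
  obtain ⟨-, m, c, lab, hc, Y, h₁, h₂, h₃, hE⟩ := h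
  refine ⟨hE.invariant (hc.isAllocation hch hσ.isAllocation h₁ h₂ h₃),
    hE.weightLT hσ (C := Set.range c) (Set.range_nonempty c) ?_ ?_ ?_⟩
  · rintro _ ⟨t, rfl⟩
    exact hc.repValue_lt hch h₁ h₂ t
  · exact fun i hi => h₃ i fun t ht => hi ⟨t, ht⟩
  · rintro _ ⟨t, rfl⟩
    obtain ⟨s, hs⟩ := hc.meets_rep t
    exact ⟨c s, ⟨s, rfl⟩, hs⟩

lemma U2.invariant_and_weightLT (h : U2 I ch σ σ')
    (hσ : Invariant I σ) : Invariant I σ' ∧ WeightLT I (weight I σ') (weight I σ) := by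
  obtain ⟨-, -, g, r, ⟨-, hg, hr, hgr⟩, hE⟩ := h
  refine ⟨hE.invariant ?_, hE.weightLT hσ (C := {r}) ⟨r, rfl⟩ ?_ ?_ ?_⟩
  · refine hσ.isAllocation.of_shift id Function.injective_id
      (fun i => if i = r then {g} else ∅) ?_ ?_ ?_
    · intro i
      split_ifs <;> simp [hg]
    · intro i j x hi hj
      split_ifs at hi hj <;> simp_all
    · intro i
      by_cases hi : i = r <;> simp [hi]
  · rintro i rfl
    rw [Function.update_self, I.val_union_singleton i (mem_pool.1 hg i), hgr, ← hr]
    exact lt_add_of_pos_right _ (I.base_pos g)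
  · exact fun i hi => Function.update_of_ne hi _ _
  · rintro i rfl
    exact ⟨i, rfl, rfl, hr⟩

lemma U4.invariant_and_weightLT (hch : IsChampChoice I ch) (h : U4 I ch σ σ')
    (hσ : Invariant I σ) : Invariant I σ' ∧ WeightLT I (weight I σ') (weight I σ) := by
  classical
  obtain ⟨-, m, p, hp, hrep, hgrp, hchamp, hedge, Y, h₁, h₂, h₃, hE⟩ := h
  have hcase : ∀ j, (∃ t, p t = j) ∨ ∀ t, p t ≠ j := fun j => by
    by_cases h : ∃ t, p t = j
    · exact Or.inl h
    · exact Or.inr (by push Not at h; exact h)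
  have hset := hch σ _ _ hchamp.1
  -- The two ends of the path share a group, so monotonicity keeps the whole path in it; its
  -- representative `p 0` therefore serves every changed agent.
  have hmono : Antitone fun t => σ.grp (p t) :=
    Fin.antitone_iff_succ_le.2 fun t => hσ.grp_le_of_edge (hedge t)
  refine ⟨hE.invariant (isAllocation_of_eq_of_mem ?_),
    hE.weightLT hσ (C := Set.range p) (Set.range_nonempty p) ?_ ?_ ?_⟩
  · have hY : ∀ i, ∀ g ∈ Y i, (i = p (Fin.last m) ∧ g ∈ pool σ.alloc) ∨
        (∃ t : Fin m, i = p t.castSucc ∧ g ∈ σ.alloc (p t.succ)) ∨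
        ((∀ t, p t ≠ i) ∧ g ∈ σ.alloc i) := by
      intro i g hg
      rcases hcase i with ⟨t, rfl⟩ | hi
      · induction t using Fin.lastCases with
        | last =>
          rw [h₂] at hg
          exact Or.inl ⟨rfl, hset.1 hg⟩
        | cast t =>
          rw [h₁] at hg
          exact Or.inr (Or.inl ⟨t, rfl, hg⟩)
      · exact Or.inr (Or.inr ⟨hi, h₃ i hi ▸ hg⟩)
    intro i j g hi hj
    rcases hY i g hi with ⟨rfl, hi₁⟩ | ⟨t, rfl, hi₁⟩ | ⟨hi₂, hi₁⟩
    · rcases hY j g hj with ⟨rfl, hj₁⟩ | ⟨u, rfl, hj₁⟩ | ⟨hj₂, hj₁⟩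
      · rfl
      · exact absurd hj₁ (mem_pool.1 hi₁ _)
      · exact absurd hj₁ (mem_pool.1 hi₁ _)
    · rcases hY j g hj with ⟨rfl, hj₁⟩ | ⟨u, rfl, hj₁⟩ | ⟨hj₂, hj₁⟩
      · exact absurd hi₁ (mem_pool.1 hj₁ _)
      · rw [Fin.succ_injective _ (hp (hσ.isAllocation.eq_of_mem hi₁ hj₁))]
      · exact absurd (hσ.isAllocation.eq_of_mem hi₁ hj₁) (hj₂ _)
    · rcases hY j g hj with ⟨rfl, hj₁⟩ | ⟨u, rfl, hj₁⟩ | ⟨hj₂, hj₁⟩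
      · exact absurd hi₁ (mem_pool.1 hj₁ _)
      · exact absurd (hσ.isAllocation.eq_of_mem hj₁ hi₁) (hi₂ _)
      · exact hσ.isAllocation.eq_of_mem hi₁ hj₁
  · rintro _ ⟨t, rfl⟩
    induction t using Fin.lastCases with
    | last => rw [h₂]; exact hset.2.1
    | cast t => rw [h₁]; exact hedge t
  · exact fun i hi => h₃ i fun t ht => hi ⟨t, ht⟩
  · rintro _ ⟨t, rfl⟩
    refine ⟨p 0, ⟨0, rfl⟩, le_antisymm ?_ (hmono (Fin.zero_le t)), hrep⟩
    exact hgrp.le.trans (hmono (Fin.le_last t))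

lemma AlgStep.invariant_and_lex (hch : IsChampChoice I ch) (h : AlgStep I ch σ σ')
    (hσ : Invariant I σ) : Invariant I σ' ∧ Prod.Lex (WeightLT I) (· < ·)
      (weight I σ', (pool σ'.alloc).card) (weight I σ, (pool σ.alloc).card) := by
  rcases h with h | ⟨-, h⟩ | ⟨-, -, h⟩ | ⟨-, -, -, h⟩
  · refine ⟨h.invariant hσ, ?_⟩
    rw [h.weight_eq]
    exact .right _ h.card_pool_lt
  · exact (h.invariant_and_weightLT hch hσ).imp_right (.left _ _)
  · exact (h.invariant_and_weightLT hσ).imp_right (.left _ _)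
  · exact (h.invariant_and_weightLT hch hσ).imp_right (.left _ _)

lemma Reachable.invariant (hch : IsChampChoice I ch) (h : Reachable I ch σ) : Invariant I σ := by
  induction h with
  | refl => exact invariant_initial
  | tail _ h ih => exact (h.invariant_and_lex hch ih).1

theorem no_infinite_run (hch : IsChampChoice I ch) :
    ¬ ∃ run : ℕ → Config n G, run 0 = initial ∧ ∀ k, AlgStep I ch (run k) (run (k + 1)) := by
  rintro ⟨run, h₀, hstep⟩
  have hinv : ∀ k, Invariant I (run k) := by
    intro k
    induction k with
    | zero => exact h₀ ▸ invariant_initial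
    | succ k ih => exact ((hstep k).invariant_and_lex hch ih).1
  have hwf : WellFounded (Prod.Lex (WeightLT I) (· < · : ℕ → ℕ → Prop)) :=
    (wellFounded_weightLT I).prod_lex wellFounded_lt
  have : IsWellFounded _ _ := ⟨hwf⟩
  obtain ⟨k, hk⟩ := WellFounded.not_rel_apply_succ
    (r := Prod.Lex (WeightLT I) (· < · : ℕ → ℕ → Prop))
    fun k => (weight I (run k), (pool (run k).alloc).card)
  exact hk ((hstep k).invariant_and_lex hch (hinv k)).2

end Rules

/-! ### Shortest-path trees -/

section Paths

variable {α : Type*} {R : α → α → Prop}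

/-- Walks of length `k` from `r` in the relation `R`. -/
def WalkTo (R : α → α → Prop) (r : α) : ℕ → α → Prop
  | 0, x => x = r
  | k + 1, x => ∃ y, WalkTo R r k y ∧ R y x

lemma exists_walkTo {r x : α} (h : Relation.ReflTransGen R r x) : ∃ k, WalkTo R r k x := by
  induction h with
  | refl => exact ⟨0, rfl⟩
  | tail _ h ih =>
    obtain ⟨k, hk⟩ := ih
    exact ⟨k + 1, _, hk, h⟩

lemma WalkTo.reflTransGen {r : α} : ∀ {k : ℕ} {x : α}, WalkTo R r k x →
    Relation.ReflTransGen R r x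
  | 0, _, h => h ▸ .refl
  | _ + 1, _, ⟨_, hy, h⟩ => hy.reflTransGen.tail h

/-- A tree of shortest paths from `r`, given by the distance from `r` and the parent function. -/
lemma exists_dist_parent (R : α → α → Prop) (r : α) : ∃ (d : α → ℕ) (p : α → α), d r = 0 ∧
    ∀ x, Relation.ReflTransGen R r x → (d x = 0 → x = r) ∧
      (x ≠ r → R (p x) x ∧ Relation.ReflTransGen R r (p x) ∧ d x = d (p x) + 1) := by
  have hle : ∀ {k x}, WalkTo R r k x → sInf {k | WalkTo R r k x} ≤ k := fun h => Nat.sInf_le h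
  have hd : ∀ x, Relation.ReflTransGen R r x →
      WalkTo R r (sInf {k | WalkTo R r k x}) x := fun x hx => Nat.sInf_mem (exists_walkTo hx)
  have hp : ∀ x, ∃ y, Relation.ReflTransGen R r x → x ≠ r → R y x ∧
      Relation.ReflTransGen R r y ∧
      sInf {k | WalkTo R r k x} = sInf {k | WalkTo R r k y} + 1 := by
    intro x
    by_cases hx : Relation.ReflTransGen R r x ∧ x ≠ r
    · have hw := hd x hx.1
      cases hk : sInf {k | WalkTo R r k x} with
      | zero =>
        rw [hk] at hw
        exact absurd hw hx.2
      | succ k =>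
        rw [hk] at hw
        obtain ⟨y, hy, hyx⟩ := hw
        have hyr := hy.reflTransGen
        have h₁ := hle hy
        have h₂ : sInf {k | WalkTo R r k x} ≤ _ := hle (k := _ + 1) ⟨y, hd y hyr, hyx⟩
        exact ⟨y, fun _ _ => ⟨hyx, hyr, by omega⟩⟩
    · exact ⟨x, fun h h' => absurd ⟨h, h'⟩ hx⟩
  choose p hp using hp
  refine ⟨fun x => sInf {k | WalkTo R r k x}, p, Nat.le_zero.1 (hle (k := 0) rfl),
    fun x hx => ⟨fun h0 => ?_, hp x hx⟩⟩
  have hw := hd x hx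
  dsimp only at h0
  rw [h0] at hw
  exact hw

/-- Follow parents from `b` back to `a`: the distance drops by one at each step, so no vertex
repeats. -/
lemma exists_injective_path {a b : α} (h : Relation.ReflTransGen R a b) :
    ∃ (m : ℕ) (p : Fin (m + 1) → α), Function.Injective p ∧ p 0 = a ∧ p (Fin.last m) = b ∧
      ∀ t : Fin m, R (p t.castSucc) (p t.succ) := by
  obtain ⟨d, q, hda, hq⟩ := exists_dist_parent R a
  have key : ∀ k, k ≤ d b → Relation.ReflTransGen R a (q^[k] b) ∧ d (q^[k] b) + k = d b := by
    intro k
    induction k with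
    | zero => exact fun _ => ⟨h, rfl⟩
    | succ k ih =>
      intro hk
      obtain ⟨h₁, h₂⟩ := ih (by omega)
      have h₃ := (hq _ h₁).2 (fun e => by rw [e, hda] at h₂; omega)
      rw [Function.iterate_succ_apply']
      exact ⟨h₃.2.1, by omega⟩
  refine ⟨d b, fun t => q^[d b - t] b, fun s t hst => ?_, ?_, by simp, fun t => ?_⟩
  · dsimp only at hst
    have h₁ := (key (d b - s) (by omega)).2
    have h₂ := (key (d b - t) (by omega)).2
    rw [hst] at h₁
    exact Fin.ext (by omega)
  · have h₁ := key (d b) le_rfl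
    exact (hq _ h₁.1).1 (by simpa using h₁.2)
  · have h₁ := key (d b - (t + 1)) (by omega)
    have h₃ := (hq _ h₁.1).2 (fun e => by rw [e, hda] at h₁; omega)
    have h₄ : d b - (t.castSucc : ℕ) = (d b - (t + 1)) + 1 := by
      have := t.isLt
      simp only [Fin.val_castSucc]
      omega
    dsimp only
    rw [h₄, Function.iterate_succ_apply', Fin.val_succ]
    exact h₃.1

end Paths

/-! ### An applicable rule can be carried out -/

section Progress

variable {n : ℕ} {G : Type*} [Fintype G] [DecidableEq G] {I : RestrictedAdditiveInstance n G}
  {ch : Config n G → Finset G → Fin n → Finset G} {σ : Config n G}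

-- Among the agents whose thresholds `S` exceeds, take one whose minimum-size set is smallest. If
-- removing a good left it above the threshold of some `j`, then `j` would have a strictly smaller
-- set.
omit [Fintype G] in
lemma exists_isChampion (hch : IsChampChoice I ch) {S : Finset G}
    (h : ∃ i, repValue I σ i < I.val i S) : ∃ i, IsChampion I ch σ i S := by
  classical
  obtain ⟨i₀, hi₀⟩ := h
  obtain ⟨i, hi, hmin⟩ := Finset.exists_min_image
    (Finset.univ.filter fun i => repValue I σ i < I.val i S) (fun i => (ch σ S i).card)
    ⟨i₀, by simpa using hi₀⟩
  simp only [Finset.mem_filter, Finset.mem_univ, true_and] at hi hmin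
  refine ⟨i, hi, fun j _ g hg => ?_⟩
  by_contra! hlt
  have hsub : ch σ S i \ {g} ⊆ S := Finset.sdiff_subset.trans (hch σ S i hi).1
  have hj : repValue I σ j < I.val j S := hlt.trans_le (I.val_mono j hsub)
  have h₁ := (hch σ S j hj).2.2 _ hsub hlt
  rw [Finset.sdiff_singleton_eq_erase] at h₁
  exact absurd ((hmin j hj).trans h₁) (not_le.2 (Finset.card_erase_lt_of_mem hg))

lemma exists_U1 (h : U1Applicable I ch σ) : ∃ σ', U1 I ch σ σ' := by
  obtain ⟨hp, m, c, lab, hc⟩ := h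
  let Y := Function.extend c (fun t => (lab t).elim (σ.alloc (c (t + 1)))
    fun g => ch σ (σ.alloc (c (t + 1)) ∪ {g}) (c t)) σ.alloc
  obtain ⟨σ', hσ'⟩ := exists_envyElimination I Y
  refine ⟨σ', hp, m, c, lab, hc, Y, fun t ht => ?_, fun t g ht => ?_, fun j hj => ?_, hσ'⟩
  · simp only [Y, hc.injective.extend_apply, ht, Option.elim_none]
  · simp only [Y, hc.injective.extend_apply, ht, Option.elim_some]
  · exact Function.extend_apply' _ _ j (by simpa using hj)

lemma exists_U2 (h : U2Applicable I ch σ) : ∃ σ', U2 I ch σ σ' := by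
  obtain ⟨h₀, h₁, g, r, hpre⟩ := h
  obtain ⟨σ', hσ'⟩ := exists_envyElimination I (Function.update σ.alloc r (σ.alloc r ∪ {g}))
  exact ⟨σ', h₀, h₁, g, r, hpre, hσ'⟩

lemma exists_U4 (hch : IsChampChoice I ch) (h : U4Applicable I σ) : ∃ σ', U4 I ch σ σ' := by
  obtain ⟨hp, i₀, hi₀⟩ := h
  obtain ⟨i, hi⟩ := exists_isChampion (σ := σ) hch ⟨i₀, (repValue_le_self I σ i₀).trans_lt hi₀⟩
  obtain ⟨r, hr, hri⟩ := exists_isRep I σ i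
  obtain ⟨m, p, hinj, rfl, rfl, hedge⟩ := exists_injective_path (hp.2.2.path r i hr hri)
  let Y := Function.extend p (fun t => Fin.lastCases (motive := fun _ => Finset G)
    (ch σ (pool σ.alloc) (p (Fin.last m))) (fun t => σ.alloc (p t.succ)) t) σ.alloc
  obtain ⟨σ', hσ'⟩ := exists_envyElimination I Y
  refine ⟨σ', ⟨hp, i₀, hi₀⟩, m, p, hinj, hr, hri, hi, hedge, Y, fun t => ?_, ?_, fun j hj => ?_,
    hσ'⟩
  · simp only [Y, hinj.extend_apply, Fin.lastCases_castSucc]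
  · simp only [Y, hinj.extend_apply, Fin.lastCases_last]
  · exact Function.extend_apply' _ _ j (by simpa using hj)

theorem exists_algStep (hch : IsChampChoice I ch) (h : ¬ Halted I ch σ) :
    ∃ σ', AlgStep I ch σ σ' := by
  by_cases h₀ : U0Applicable I σ
  · obtain ⟨g, r, hpre⟩ := h₀
    exact ⟨_, Or.inl ⟨g, r, hpre, rfl⟩⟩
  by_cases h₁ : U1Applicable I ch σ
  · obtain ⟨σ', hσ'⟩ := exists_U1 h₁
    exact ⟨σ', Or.inr (Or.inl ⟨h₀, hσ'⟩)⟩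
  by_cases h₂ : U2Applicable I ch σ
  · obtain ⟨σ', hσ'⟩ := exists_U2 h₂
    exact ⟨σ', Or.inr (Or.inr (Or.inl ⟨h₀, h₁, hσ'⟩))⟩
  by_cases h₄ : U4Applicable I σ
  · obtain ⟨σ', hσ'⟩ := exists_U4 hch h₄
    exact ⟨σ', Or.inr (Or.inr (Or.inr ⟨h₀, h₁, h₂, hσ'⟩))⟩
  exact absurd ⟨h₀, h₁, h₂, h₄⟩ h

end Progress

/-! ### The bound on the pool -/

section PoolSize

variable {n : ℕ} {G : Type*} [Fintype G] [DecidableEq G] {I : RestrictedAdditiveInstance n G}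
  {ch : Config n G → Finset G → Fin n → Finset G} {σ : Config n G}

/-- Without `U₂` representatives value `g` at 0, and without `U₀` someone's threshold is exceeded. A
champion who is a representative would already have an edge to `r` without `g`, but no edge ends at
a representative. -/
lemma Invariant.exists_champion_not_isRep (hσ : Invariant I σ) (hch : IsChampChoice I ch)
    (h₀ : ¬ U0Applicable I σ) (h₁ : ¬ U1Applicable I ch σ) (h₂ : ¬ U2Applicable I ch σ)
    {g : G} (hg : g ∈ pool σ.alloc) {r : Fin n} (hr : IsRep I σ r) :
    ∃ i, IsChampion I ch σ i (σ.alloc r ∪ {g}) ∧ ¬ IsRep I σ i := by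
  have hzero : ∀ q, IsRep I σ q → I.val q {g} = 0 := fun q hq =>
    (I.restricted q g).resolve_right fun e => h₂ ⟨h₀, h₁, g, q, hσ.proper, hg, hq, e⟩
  have henvy : ∃ i, repValue I σ i < I.val i (σ.alloc r ∪ {g}) := by
    by_contra! hno
    exact h₀ ⟨g, r, hσ.proper, hg, hr, hzero r hr, hno⟩
  obtain ⟨i, hi⟩ := exists_isChampion hch henvy
  refine ⟨i, hi, fun hrep => hi.1.not_ge ?_⟩
  rw [I.val_union_singleton i (mem_pool.1 hg r), hzero i hrep, add_zero]
  exact hσ.no_edge_to_rep i r hr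

/-- If the representatives of all groups with at least two members can be given distinct labels
such that each of them has an incoming champion edge with her label from an agent who is not a
representative, then there is a champion cycle. -/
lemma Invariant.exists_isChampionCycle (hσ : Invariant I σ) (B : Finset (Fin n))
    (hB : ∀ i r, IsRep I σ r → ¬ IsRep I σ i → σ.grp r = σ.grp i → r ∈ B) (f : Fin n → G)
    (hf : Set.InjOn f B) (cp : Fin n → Fin n)
    (hcp : ∀ r ∈ B, IsRep I σ r → ¬ IsRep I σ (cp r) ∧ ChampionEdge I ch σ (cp r) r (f r))
    (x₀ : Fin n) (hx₀ : ¬ IsRep I σ x₀) :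
    ∃ (m : ℕ) (c : Fin (m + 1) → Fin n) (lab : Fin (m + 1) → Option G),
      IsChampionCycle I ch σ c lab := by
  classical
  choose ρ hρ hρg using exists_isRep I σ
  choose d p _ hp using fun r => exists_dist_parent (RegularEdge I σ) r
  have hpath : ∀ x, Relation.ReflTransGen (RegularEdge I σ) (ρ x) x := fun x =>
    hσ.proper.2.2.path _ _ (hρ x) (hρg x)
  -- `F` picks a predecessor: the tree parent inside the group for a non-representative, the chosen
  -- champion for a representative.
  let F : Fin n → Fin n := fun x => if IsRep I σ x then cp x else p (ρ x) x
  have hFrep : ∀ x, IsRep I σ x → F x = cp x := fun x hx => if_pos hx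
  have hF : ∀ x, ¬ IsRep I σ x → RegularEdge I σ (F x) x ∧ σ.grp (F x) = σ.grp x ∧
      d (ρ x) x = d (ρ x) (F x) + 1 := by
    intro x hx
    have hFx : F x = p (ρ x) x := if_neg hx
    have h₁ := (hp (ρ x) x (hpath x)).2 fun e => hx (e ▸ hρ x)
    rw [← hFx] at h₁
    refine ⟨h₁.1, le_antisymm ?_ (hσ.grp_le_of_edge h₁.1), h₁.2.2⟩
    exact (hσ.grp_le_of_path h₁.2.1).trans (hρg x).le
  have hρeq : ∀ x y, σ.grp x = σ.grp y → ρ x = ρ y := fun x y hxy =>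
    hσ.rep_unique _ _ (hρ x) (hρ y) (by rw [hρg, hρg, hxy])
  have hB' : ∀ x, ¬ IsRep I σ x → ρ x ∈ B := fun x hx => hB x _ (hρ x) hx (hρg x)
  have hρself : ∀ x, IsRep I σ x → ρ x = x := fun x hx =>
    hσ.rep_unique _ _ (hρ x) hx (hρg x)
  -- Iterates of `F` stay in groups whose representatives lie in `B`, the only ones with labels.
  have hFB : ∀ x, ρ x ∈ B → ρ (F x) ∈ B := by
    intro x hx
    by_cases hr : IsRep I σ x
    · rw [hρself x hr] at hx
      rw [hFrep x hr]
      exact hB' _ (hcp x hx hr).1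
    · rw [hρeq _ _ (hF x hr).2.1]
      exact hx
  have hiter : ∀ k x, ρ x ∈ B → ρ (F^[k] x) ∈ B := by
    intro k
    induction k with
    | zero => exact fun x hx => hx
    | succ k ih => exact fun x hx => ih _ (hFB x hx)
  -- Within a group `F` decreases the distance to the representative, so it reaches the
  -- representative before leaving the group.
  have hreach : ∀ k x, d (ρ x) x = k →
      ∃ j, σ.grp (F^[j] x) = σ.grp x ∧ IsRep I σ (F^[j] x) := by
    intro k
    induction k with
    | zero => exact fun x hx => ⟨0, rfl, (hp _ x (hpath x)).1 hx ▸ hρ x⟩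
    | succ k ih =>
      intro x hx
      by_cases hr : IsRep I σ x
      · exact ⟨0, rfl, hr⟩
      · obtain ⟨-, h₂, h₃⟩ := hF x hr
        obtain ⟨j, hj, hj'⟩ := ih (F x) (by rw [hρeq _ _ h₂]; omega)
        exact ⟨j + 1, hj.trans h₂, hj'⟩
  -- By finiteness the iterates of `F` from `x₀` eventually repeat.
  obtain ⟨y, hy, hyB⟩ : ∃ y, y ∈ Function.periodicPts F ∧ ρ y ∈ B := by
    obtain ⟨a, b, hab, he⟩ := Finite.exists_ne_map_eq_of_infinite fun k : ℕ => F^[k] x₀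
    wlog hlt : a < b generalizing a b
    · exact this b a hab.symm he.symm (by omega)
    refine ⟨F^[a] x₀, ⟨b - a, by omega, ?_⟩, hiter a x₀ (hB' x₀ hx₀)⟩
    rw [Function.IsPeriodicPt, Function.IsFixedPt, ← Function.iterate_add_apply,
      Nat.sub_add_cancel hlt.le, he]
  obtain ⟨m, hm⟩ := Nat.exists_eq_succ_of_ne_zero
    (Function.minimalPeriod_pos_of_mem_periodicPts hy).ne'
  -- `F` goes against the edges, so the periodic orbit of length `m + 1` is listed in reverse.
  let c : Fin (m + 1) → Fin n := fun t => F^[m - t] y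
  have hcF : ∀ t, F (c (t + 1)) = c t := by
    intro t
    simp only [c, ← Function.iterate_succ_apply' F]
    induction t using Fin.lastCases with
    | last =>
      have : F^[m + 1] y = y := by
        have := Function.iterate_minimalPeriod (f := F) (x := y)
        rwa [hm] at this
      simpa using this
    | cast t =>
      rw [Fin.coeSucc_eq_succ, Fin.val_succ, Fin.val_castSucc]
      congr 2
      omega
  have hcB : ∀ t, IsRep I σ (c t) → c t ∈ B := fun t ht => by
    rw [← hρself _ ht]
    exact hiter _ y hyB
  have hcinj : Function.Injective c := by
    intro s t hst
    have h₁ := Function.iterate_injOn_Iio_minimalPeriod (f := F) (x := y)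
      (x₁ := m - s) (by simp only [Set.mem_Iio]; omega) (x₂ := m - t)
      (by simp only [Set.mem_Iio]; omega) hst
    exact Fin.ext (by omega)
  let lab : Fin (m + 1) → Option G := fun t =>
    if IsRep I σ (c (t + 1)) then some (f (c (t + 1))) else none
  have hlab : ∀ t g, lab t = some g → IsRep I σ (c (t + 1)) ∧ f (c (t + 1)) = g := by
    intro t g hg
    simp only [lab] at hg
    split_ifs at hg with hr
    exact ⟨hr, Option.some.inj hg⟩
  refine ⟨m, c, lab, hcinj, fun t ht => ?_, fun t g ht => ?_, fun t g ht => (hlab t g ht).1,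
    fun s t g hs ht => ?_, fun t => ?_⟩
  · have hr : ¬ IsRep I σ (c (t + 1)) := by
      intro hr
      simp [lab, hr] at ht
    have h₁ := (hF _ hr).1
    rwa [hcF] at h₁
  · obtain ⟨hr, rfl⟩ := hlab t g ht
    have h₁ := (hcp _ (hcB _ hr) hr).2
    rwa [← hFrep _ hr, hcF] at h₁
  · obtain ⟨hs₁, hs₂⟩ := hlab s g hs
    obtain ⟨ht₁, ht₂⟩ := hlab t g ht
    exact add_right_cancel (hcinj (hf (hcB _ hs₁) (hcB _ ht₁) (hs₂.trans ht₂.symm)))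
  · obtain ⟨j, hj⟩ := hreach _ (c t) rfl
    have hmod := Nat.mod_lt (j + (m - (t : ℕ))) (Nat.succ_pos m)
    rw [Nat.succ_eq_add_one] at hmod
    -- `F^[j] (c t)` is `F^[j + (m - t)] y`; reducing the exponent modulo the period gives its
    -- position on the cycle.
    refine ⟨⟨m - (j + (m - t)) % (m + 1), by omega⟩, ?_⟩
    have h₁ : c ⟨m - (j + (m - t)) % (m + 1), by omega⟩ = F^[j] (c t) := by
      simp only [c]
      rw [← Function.iterate_add_apply, Nat.sub_sub_self (by omega)]
      have h₂ := Function.iterate_mod_minimalPeriod_eq (f := F) (x := y) (n := j + (m - t))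
      rwa [hm] at h₂
    rwa [h₁]

theorem Invariant.card_pool_lt (hσ : Invariant I σ) (hch : IsChampChoice I ch)
    (h₀ : ¬ U0Applicable I σ) (h₁ : ¬ U1Applicable I ch σ) (h₂ : ¬ U2Applicable I ch σ)
    (hn : 2 ≤ n) : (pool σ.alloc).card < n / 2 := by
  classical
  by_contra! hge
  obtain ⟨g₀, hg₀⟩ : (pool σ.alloc).Nonempty := Finset.card_pos.1 (by omega)
  choose ρ hρ hρg using exists_isRep I σ
  have hchamp := fun {g} (hg : g ∈ pool σ.alloc) {r} (hr : IsRep I σ r) =>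
    hσ.exists_champion_not_isRep hch h₀ h₁ h₂ hg hr
  obtain ⟨x₀, -, hx₀⟩ := hchamp hg₀ (hρ ⟨0, by omega⟩)
  let N : Finset (Fin n) := Finset.univ.filter fun i => ¬ IsRep I σ i
  let B : Finset (Fin n) := N.image ρ
  have hBrep : ∀ r ∈ B, IsRep I σ r := by
    intro r hr
    obtain ⟨i, -, rfl⟩ := Finset.mem_image.1 hr
    exact hρ i
  -- `B` is the image of the non-representatives `N` and is disjoint from it, so `2 * B.card ≤ n`.
  have hcard : B.card ≤ (pool σ.alloc).card := by
    have hd : Disjoint B N := Finset.disjoint_left.2 fun r hr hr' =>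
      (Finset.mem_filter.1 hr').2 (hBrep r hr)
    have h₃ : B.card ≤ N.card := Finset.card_image_le
    have h₄ : (B ∪ N).card ≤ n := (Finset.card_le_univ _).trans_eq (by simp)
    rw [Finset.card_union_of_disjoint hd] at h₄
    omega
  obtain ⟨e⟩ : Nonempty (B ↪ (pool σ.alloc : Finset G)) :=
    Function.Embedding.nonempty_of_card_le (by simpa using hcard)
  -- Outside `B` the label `g₀` is a dummy; injectivity is needed only on `B`.
  let f : Fin n → G := fun r => if h : r ∈ B then e ⟨r, h⟩ else g₀
  have hf : ∀ r (h : r ∈ B), f r = e ⟨r, h⟩ := fun r h => dif_pos h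
  have hcp : ∀ r, ∃ i, r ∈ B → ¬ IsRep I σ i ∧ ChampionEdge I ch σ i r (f r) := by
    intro r
    by_cases hr : r ∈ B
    · have hmem : f r ∈ pool σ.alloc := hf r hr ▸ (e ⟨r, hr⟩).2
      obtain ⟨i, hi, hi'⟩ := hchamp hmem (hBrep r hr)
      exact ⟨i, fun _ => ⟨hi', hmem, hi⟩⟩
    · exact ⟨r, fun h => absurd h hr⟩
  choose cp hcp using hcp
  refine h₁ ⟨hσ.proper, hσ.exists_isChampionCycle B ?_ f ?_ cp (fun r hr _ => hcp r hr) x₀ hx₀⟩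
  · intro i r hr hi hri
    refine Finset.mem_image.2 ⟨i, by simpa [N] using hi, ?_⟩
    exact hσ.rep_unique _ _ (hρ i) hr ((hρg i).trans hri.symm)
  · intro r hr q hq hrq
    rw [hf r hr, hf q hq] at hrq
    simpa using e.injective (Subtype.ext hrq)

end PoolSize

end FairDivision

/-! ### The theorem -/

theorem mainTheorem2 {n : ℕ} {G : Type*} [Fintype G] [DecidableEq G]
    (I : FairDivision.RestrictedAdditiveInstance n G)
    (ch : FairDivision.Config n G → Finset G → Fin n → Finset G)
    (hch : FairDivision.IsChampChoice I ch) :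
    -- every execution is finite
    (¬ ∃ run : ℕ → FairDivision.Config n G, run 0 = FairDivision.initial ∧
      ∀ k, FairDivision.AlgStep I ch (run k) (run (k + 1))) ∧
    ∀ σ : FairDivision.Config n G, FairDivision.Reachable I ch σ →
      -- an execution never gets stuck before the exit condition holds
      (¬ FairDivision.Halted I ch σ → ∃ σ', FairDivision.AlgStep I ch σ σ') ∧
      -- and what it returns has the required properties
      (FairDivision.Halted I ch σ →
        FairDivision.IsAllocation σ.alloc ∧
        FairDivision.IsEFX I.val σ.alloc ∧
        (∀ i, I.val i (FairDivision.pool σ.alloc) ≤ I.val i (σ.alloc i)) ∧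
        (2 ≤ n → (FairDivision.pool σ.alloc).card < n / 2)) := by
  refine ⟨FairDivision.no_infinite_run hch, fun σ hreach => ?_⟩
  have hσ := hreach.invariant hch
  refine ⟨FairDivision.exists_algStep hch, fun ⟨h₀, h₁, h₂, h₄⟩ => ?_⟩
  refine ⟨hσ.isAllocation, hσ.proper.1, fun i => ?_, hσ.card_pool_lt hch h₀ h₁ h₂⟩
  exact not_lt.1 fun hlt => h₄ ⟨hσ.proper, i, hlt⟩
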